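/- **Model.** There are $J$ goods. Fix vectors $\bm l,\bm u\in\mathbb R^J$ with positive entries, let $\mathcal S=\{\bm p\in\mathbb R^J:\bm l\le \bm p\le \bm u\}$ (componentwise), and let $0<\pi<1$. Agent $i$ has random functions $Y_i(w,\bm p)\in\mathbb R$ (outcome), $\bm D_i(w,\bm p)\in\mathbb R^J$ (demand), $\bm S_i(w,\bm p)\in\mathbb R^J$ (supply) of her own treatment $w\in\{0,1\}$ and of the price $\bm p$ she faces; these triples are drawn i.i.d. from a law $\Theta$ on a set $\mathcal G$ of such triples. Put $\bm Z_i=\bm D_i-\bm S_i$, $y(w,\bm p)=\mathbb E[Y_i(w,\bm p)]$, $\bm z_q(\bm p)=q\,\mathbb E[\bm Z_i(1,\bm p)]+(1-q)\,\mathbb E[\bm Z_i(0,\bm p)]$, and let $\bm p^*_q$ be the zero of $\bm z_q$ in $\mathcal S$. **Assumptions on the market.** 1. For $w\in\{0,1\}$ and $\bm p\ge \bm u$, $\bm Z_i(w,\bm p)\le 0$ for all members of $\mathcal G$, with strict inequality (in every component) on a set of positive $\Theta$-measure; and $\bm Z_i(w,\bm l)\ge 0$ for all members of $\mathcal G$,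 with strict inequality on a set of positive $\Theta$-measure. 2. On some open set containing $\mathcal S$, the functions $Y_i(w,\cdot),\bm D_i(w,\cdot),\bm S_i(w,\cdot)$ are twice continuously differentiable, and they and their first two derivatives are bounded there, uniformly over $\mathcal G$. 3. The Jacobian $\nabla_{\bm p}\bm z_\pi(\bm p^*_\pi)$ has full rank; the map $\bm f(\bm p)=\bm z_\pi(\bm p)+\bm p$ satisfies $\|\nabla \bm f(\bm p)\|<1$ (operator norm) for all $\bm p\in\mathcal S$; and, for $W_i\sim$ Bernoulli$(\pi)$ independent of the agent, $\mathbb E[\bm Z_i(W_i,\bm p^*_\pi)\bm Z_i(W_i,\bm p^*_\pi)^\top]$ has full rank. 4. There are $B>0$ and a sequence $a_n$ with $n a_n\to 0$ such that, for every choice of $n\times J$ matrices $\bm U^{(n)}$ with entries in $[-B,B]$, i.i.d. agents and independent Bernoulli$(\pi)$ treatments $W_i$, with probability tending to one there is $\bm p\in\mathcal S$ with $\big\|\frac1n\sum_{i=1}^n\bm Z_i(W_i,\bm p+\bm U^{(n)}_i)\big\|\le a_n$. **Augmented experiment.** For each $n$, the agents $i=1,\dots,n$ are drawn i.i.d. from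 $\Theta$; the treatments $W_i$ are i.i.d. Bernoulli$(\pi)$; the price perturbations $U_{ij}$ ($i\le n$, $j\le J$) are i.i.d. uniform on $\{-h_n,+h_n\}$, with $h_n=cn^{-\alpha}$, $c>0$, $\frac14<\alpha<\frac12$; agents, treatments and perturbations are independent. The market price $\tilde{\bm P}$ is a minimizer over $\bm p\in\mathcal S$ of $\big\|\frac1n\sum_i\bm Z_i(W_i,\bm p+\bm U_i)\big\|$ (ties broken arbitrarily). One observes $Y_i=Y_i(W_i,\tilde{\bm P}+\bm U_i)$ and $\bm Z_i=\bm Z_i(W_i,\tilde{\bm P}+\bm U_i)$. **Estimators.** With $\bm U$ the $n\times J$ matrix of perturbations, $\bm Y$ the $n$-vector of outcomes and $\bm Z$ the $n\times J$ matrix of excess demands, $$\hat\tau_{\rm ADE}=\frac1n\sum_{i=1}^n\Big(\frac{W_iY_i}{\pi}-\frac{(1-W_i)Y_i}{1-\pi}\Big),\qquad \hat\tau_{\rm AIE}=-\hat{\bm\Delta}_y^\top\hat{\bm\Delta}_z^{-1}\hat{\bm\tau}_z^{HT},$$ $$\hat{\bm\Delta}_y=(\bm U^\top\bm U)^{-1}\bm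 U^\top\bm Y,\qquad \hat{\bm\Delta}_z=\big[(\bm U^\top\bm U)^{-1}\bm U^\top\bm Z\big]^\top,\qquad \hat{\bm\tau}^{HT}_z=\frac1n\sum_{i=1}^n\Big(\frac{W_i\bm Z_i}{\pi}-\frac{(1-W_i)\bm Z_i}{1-\pi}\Big),$$ so that row $k$ of $\hat{\bm\Delta}_z$ holds the coefficients of the regression of the excess demand for good $k$ on the perturbations. **Theorem.** For all $q$ near $\pi$ the function $\bm z_q$ has exactly one zero $\bm p^*_q$ in $\mathcal S$, the map $q\mapsto\bm p^*_q$ is differentiable at $\pi$, $\bm p\mapsto \pi y(1,\bm p)+(1-\pi)y(0,\bm p)$ is differentiable at $\bm p^*_\pi$, and, as $n\to\infty$, $$\hat\tau_{\rm ADE}\to_p\tau^*_{\rm ADE}=y(1,\bm p^*_\pi)-y(0,\bm p^*_\pi),$$ $$\hat\tau_{\rm AIE}\to_p\tau^*_{\rm AIE}=\nabla_{\bm p}\big[\pi y(1,\bm p)+(1-\pi)y(0,\bm p)\big]_{\bm p=\bm p^*_\pi}^\top\,\frac{d}{d\pi}\bm p^*_\pi .$$ -/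

import Mathlib

open MeasureTheory ProbabilityTheory Filter Topology
open scoped Matrix

noncomputable section

/-- Price vectors for `J` goods, with the Euclidean norm. -/
abbrev Price (J : ℕ) : Type := EuclideanSpace ℝ (Fin J)

/-- The box `{p : l ≤ p ≤ u}` of admissible prices (componentwise order). -/
def priceBox {J : ℕ} (l u : Price J) : Set (Price J) :=
  {p | ∀ j, l j ≤ p j ∧ p j ≤ u j}

/-- A population of agents. An agent `g : G` is described by an outcome function, a demand
function and a supply function of the agent's own treatment (`true` is treated, `false` is
control) and of the price vector that the agent faces. -/
structure Market (J : ℕ) (G : Type*) where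
  /-- outcome -/
  Y : G → Bool → Price J → ℝ
  /-- demand -/
  D : G → Bool → Price J → Price J
  /-- supply -/
  S : G → Bool → Price J → Price J

/-- The Bernoulli(`π`) law of a treatment. -/
def treatmentLaw (π : ℝ) : Measure Bool :=
  ENNReal.ofReal π • Measure.dirac true + ENNReal.ofReal (1 - π) • Measure.dirac false

/-- The uniform law on the two points `h` and `-h`. -/
def perturbationLaw (h : ℝ) : Measure ℝ :=
  (2 : ENNReal)⁻¹ • Measure.dirac h + (2 : ENNReal)⁻¹ • Measure.dirac (-h)

namespace Market

/-- Excess demand of an agent. -/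
def Z {J : ℕ} {G : Type*} (M : Market J G) (g : G) (w : Bool) (p : Price J) : Price J :=
  M.D g w p - M.S g w p

/-! ### Mean-field quantities; agents are distributed according to `Θ`. -/

/-- `y(w, p) = E[Y_i(w, p)]` -/
def y {J : ℕ} {G : Type*} [MeasurableSpace G] (M : Market J G) (Θ : Measure G)
    (w : Bool) (p : Price J) : ℝ :=
  ∫ g, M.Y g w p ∂Θ

/-- `d(w, p) = E[D_i(w, p)]` -/
def d {J : ℕ} {G : Type*} [MeasurableSpace G] (M : Market J G) (Θ : Measure G)
    (w : Bool) (p : Price J) : Price J :=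
  ∫ g, M.D g w p ∂Θ

/-- `s(w, p) = E[S_i(w, p)]` -/
def s {J : ℕ} {G : Type*} [MeasurableSpace G] (M : Market J G) (Θ : Measure G)
    (w : Bool) (p : Price J) : Price J :=
  ∫ g, M.S g w p ∂Θ

/-- Expected excess demand when a fraction `π` is treated. -/
def z {J : ℕ} {G : Type*} [MeasurableSpace G] (M : Market J G) (Θ : Measure G)
    (π : ℝ) (p : Price J) : Price J :=
  π • (M.d Θ true p - M.s Θ true p) + (1 - π) • (M.d Θ false p - M.s Θ false p)

/-- Expected outcome `π y(1, p) + (1 - π) y(0, p)` when a fraction `π` is treated. -/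
def yBar {J : ℕ} {G : Type*} [MeasurableSpace G] (M : Market J G) (Θ : Measure G)
    (π : ℝ) (p : Price J) : ℝ :=
  π * M.y Θ true p + (1 - π) * M.y Θ false p

/-- `p` is a price of the box at which the mean-field excess demand vanishes. -/
def IsMeanFieldPrice {J : ℕ} {G : Type*} [MeasurableSpace G] (M : Market J G) (Θ : Measure G)
    (l u : Price J) (π : ℝ) (p : Price J) : Prop :=
  p ∈ priceBox l u ∧ M.z Θ π p = 0

/-- The mean-field market price `p*_π` (the mean-field price, where it exists and is unique). -/
def pStar {J : ℕ} {G : Type*} [MeasurableSpace G] (M : Market J G) (Θ : Measure G)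
    (l u : Price J) (π : ℝ) : Price J :=
  Classical.epsilon (M.IsMeanFieldPrice Θ l u π)

/-- The mean-field direct effect `y(1, p*_π) - y(0, p*_π)`. -/
def tauStarADE {J : ℕ} {G : Type*} [MeasurableSpace G] (M : Market J G) (Θ : Measure G)
    (l u : Price J) (π : ℝ) : ℝ :=
  M.y Θ true (M.pStar Θ l u π) - M.y Θ false (M.pStar Θ l u π)

/-- The mean-field indirect effect `∇_p [π y(1, p*_π) + (1 - π) y(0, p*_π)]ᵀ (d/dπ) p*_π`;
the gradient is taken with `π` fixed. -/
def tauStarAIE {J : ℕ} {G : Type*} [MeasurableSpace G] (M : Market J G) (Θ : Measure G)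
    (l u : Price J) (π : ℝ) : ℝ :=
  inner ℝ (gradient (M.yBar Θ π) (M.pStar Θ l u π)) (deriv (M.pStar Θ l u) π)

/-! ### Finite markets: agents `a`, treatments `w`, and an `n × J` matrix `U` of individual
price perturbations. -/

/-- The price faced by agent `i` when the market price is `p`. -/
def facedPrice {J n : ℕ} (U : Matrix (Fin n) (Fin J) ℝ) (p : Price J) (i : Fin n) : Price J :=
  p + WithLp.toLp 2 (U i)

/-- Average excess demand at the market price `p`. -/
def avgExcess {J n : ℕ} {G : Type*} (M : Market J G) (a : Fin n → G) (w : Fin n → Bool)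
    (U : Matrix (Fin n) (Fin J) ℝ) (p : Price J) : Price J :=
  (n : ℝ)⁻¹ • ∑ i, M.Z (a i) (w i) (facedPrice U p i)

/-- `p` is a market price: among the prices of the box it comes closest to clearing the market. -/
def IsMarketPrice {J n : ℕ} {G : Type*} (M : Market J G) (l u : Price J) (a : Fin n → G)
    (w : Fin n → Bool) (U : Matrix (Fin n) (Fin J) ℝ) (p : Price J) : Prop :=
  p ∈ priceBox l u ∧ ∀ q ∈ priceBox l u, ‖M.avgExcess a w U p‖ ≤ ‖M.avgExcess a w U q‖

/-- Observed outcomes at the market price `p`. -/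
def obsY {J n : ℕ} {G : Type*} (M : Market J G) (a : Fin n → G) (w : Fin n → Bool)
    (U : Matrix (Fin n) (Fin J) ℝ) (p : Price J) : Fin n → ℝ :=
  fun i => M.Y (a i) (w i) (facedPrice U p i)

/-- The `n × J` matrix of observed excess demands at the market price `p`. -/
def obsZ {J n : ℕ} {G : Type*} (M : Market J G) (a : Fin n → G) (w : Fin n → Bool)
    (U : Matrix (Fin n) (Fin J) ℝ) (p : Price J) : Matrix (Fin n) (Fin J) ℝ :=
  Matrix.of fun i j => M.Z (a i) (w i) (facedPrice U p i) j

end Market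

/-! ### Estimators -/

/-- The Horvitz–Thompson estimator of a treatment effect from treatments `w` and data `v`. -/
def horvitzThompson {n : ℕ} (π : ℝ) (w : Fin n → Bool) (v : Fin n → ℝ) : ℝ :=
  (n : ℝ)⁻¹ * ∑ i, ((if w i then 1 else 0) * v i / π - (1 - if w i then 1 else 0) * v i / (1 - π))

/-- Ordinary least squares coefficients `(UᵀU)⁻¹ (Uᵀ v)` of `v` on the columns of `U`. -/
def ols {J n : ℕ} (U : Matrix (Fin n) (Fin J) ℝ) (v : Fin n → ℝ) : Fin J → ℝ :=
  (Uᵀ * U)⁻¹ *ᵥ (Uᵀ *ᵥ v)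

/-- Estimated Jacobian of excess demand: row `k` holds the coefficients of the regression of the
excess demand for good `k` on the price perturbations. -/
def jacobianHat {J n : ℕ} (U Z : Matrix (Fin n) (Fin J) ℝ) : Matrix (Fin J) (Fin J) ℝ :=
  Matrix.of fun k => ols U (fun i => Z i k)

namespace Market

/-- The estimator of the direct effect. -/
def tauHatADE {J n : ℕ} {G : Type*} (M : Market J G) (π : ℝ) (a : Fin n → G) (w : Fin n → Bool)
    (U : Matrix (Fin n) (Fin J) ℝ) (p : Price J) : ℝ :=
  horvitzThompson π w (M.obsY a w U p)

/-- The plug-in estimator `-Δ_yᵀ Δ_z⁻¹ τ_z` of the indirect effect. -/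
def tauHatAIE {J n : ℕ} {G : Type*} (M : Market J G) (π : ℝ) (a : Fin n → G) (w : Fin n → Bool)
    (U : Matrix (Fin n) (Fin J) ℝ) (p : Price J) : ℝ :=
  -(ols U (M.obsY a w U p) ⬝ᵥ
    ((jacobianHat U (M.obsZ a w U p))⁻¹ *ᵥ
      fun k => horvitzThompson π w (fun i => M.obsZ a w U p i k)))

/-! ### Assumptions on the market -/

/-- `F` is measurable in the agent, twice continuously differentiable in the price on `O`, and
its values and its first two price derivatives are bounded on `O`, uniformly in the agent. -/
structure SmoothBounded {J : ℕ} {G E : Type*} [MeasurableSpace G] [NormedAddCommGroup E]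
    [NormedSpace ℝ E] [MeasurableSpace E] (F : G → Bool → Price J → E) (O : Set (Price J)) :
    Prop where
  measurable : ∀ w p, Measurable fun g => F g w p
  contDiffOn : ∀ g w, ContDiffOn ℝ 2 (F g w) O
  bounded : ∃ C : ℝ, ∀ g w, ∀ p ∈ O, ∀ r ≤ 2, ‖iteratedFDeriv ℝ r (F g w) p‖ ≤ C

/-- The standing assumptions on the market, for agents drawn from `Θ`, the price box between
`l` and `u`, and treatment probability `π`. -/
structure Assumptions {J : ℕ} {G : Type*} [MeasurableSpace G] (M : Market J G) (Θ : Measure G)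
    (l u : Price J) (π : ℝ) : Prop where
  l_pos : ∀ j, 0 < l j
  u_pos : ∀ j, 0 < u j
  /-- at high prices no good is in excess demand, and some agents are in strict excess supply -/
  upper : ∀ w p, (∀ j, u j ≤ p j) →
    (∀ g j, M.Z g w p j ≤ 0) ∧ 0 < Θ {g | ∀ j, M.Z g w p j < 0}
  /-- at the lower price no good is in excess supply, and some agents are in strict excess
  demand -/
  lower : ∀ w, (∀ g j, 0 ≤ M.Z g w l j) ∧ 0 < Θ {g | ∀ j, 0 < M.Z g w l j}
  /-- smoothness and boundedness around the price box -/
  smooth : ∃ O : Set (Price J), IsOpen O ∧ priceBox l u ⊆ O ∧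
    SmoothBounded M.Y O ∧ SmoothBounded M.D O ∧ SmoothBounded M.S O
  /-- the Jacobian of mean-field excess demand has full rank at the mean-field price -/
  jacobian_full_rank : Function.Bijective (fderiv ℝ (M.z Θ π) (M.pStar Θ l u π))
  /-- the Jacobian of `p ↦ z_π(p) + p` has operator norm below one on the box -/
  contraction : ∀ p ∈ priceBox l u, ‖fderiv ℝ (fun q => M.z Θ π q + q) p‖ < 1
  /-- the second moment matrix of `Z_i(W_i, p*_π)` has full rank -/
  second_moment_full_rank :
    (Matrix.of fun j k : Fin J =>
      π * ∫ g, M.Z g true (M.pStar Θ l u π) j * M.Z g true (M.pStar Θ l u π) k ∂Θ +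
      (1 - π) * ∫ g, M.Z g false (M.pStar Θ l u π) j * M.Z g false (M.pStar Θ l u π) k ∂Θ).det ≠ 0
  /-- in finite markets, with perturbations of size at most `B`, some price of the box clears the
  market up to an error `a n` of smaller order than `1 / n`, with probability tending to one -/
  approx_clearing : ∃ B : ℝ, 0 < B ∧ ∃ a : ℕ → ℝ, Tendsto (fun n : ℕ => n * a n) atTop (𝓝 0) ∧
    ∀ U : (n : ℕ) → Matrix (Fin n) (Fin J) ℝ, (∀ n i j, |U n i j| ≤ B) →
      Tendsto (fun n : ℕ =>
        Measure.pi (fun _ : Fin n => Θ.prod (treatmentLaw π))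
          {x | ¬ ∃ p ∈ priceBox l u,
            ‖M.avgExcess (fun i => (x i).1) (fun i => (x i).2) (U n) p‖ ≤ a n})
        atTop (𝓝 0)

end Market

/-- The augmented experiment: for every `n`, the agents `A n ω i` are drawn from `Θ`, the
treatments `W n ω i` from Bernoulli(`π`), the perturbations `U n ω i j` uniformly from
`{-h n, h n}`, all independently of each other. -/
def IsAugmentedExperiment {J : ℕ} {G Ω : Type*} [MeasurableSpace G] [MeasurableSpace Ω]
    (μ : Measure Ω) (Θ : Measure G) (π : ℝ) (h : ℕ → ℝ)
    (A : (n : ℕ) → Ω → Fin n → G) (W : (n : ℕ) → Ω → Fin n → Bool)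
    (U : (n : ℕ) → Ω → Matrix (Fin n) (Fin J) ℝ) : Prop :=
  ∀ n : ℕ, HasLaw
    (fun ω => (fun i => (A n ω i, W n ω i, U n ω i) : Fin n → G × Bool × (Fin J → ℝ)))
    (Measure.pi fun _ : Fin n =>
      Θ.prod ((treatmentLaw π).prod (Measure.pi fun _ : Fin J => perturbationLaw (h n)))) μ

end

/-! The random market price is compared with the deterministic zero p* of `z_π`, after which only
laws of large numbers for bounded i.i.d. summands evaluated at p* are needed.

Since `z_π + id` has derivative of norm at most ρ < 1 near the box, (1 - ρ)‖p - q‖ ≤ ‖z_π(p) -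
z_π(q)‖ there (`le_norm_z_sub`). So zeros are unique, and a small value of `z_π` forces proximity to
p*. Existence comes from approximate clearing of finite markets, carried to the mean field by a
uniform law of large numbers. Applied with a constant perturbation v, the same argument puts p* - v
in the box for every small v, so p* is interior. The implicit function theorem then gives the
derivative d of q ↦ p*_q, with A d = -Δ, where A is the Jacobian of `z_π` at p* and Δ the effect of
treatment on mean excess demand at p*.

The market price satisfies ‖P - p*‖ = O(h) (`exists_eventually_norm_sub_le`). As n h² → ∞, the
centred sample excess demand at p* is o(h); perturbing prices changes it by O(h), so the minimizer
also leaves an excess of O(h). Once P is known to be consistent, sample and mean increments between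
p* and P differ by a small multiple of ‖P - p*‖, which the lower bound above absorbs.

Lipschitz bounds now carry the Horvitz–Thompson averages to p*. In the regressions
(`tendsto_regression`) a Taylor expansion at p* separates the perturbations, whose signs are centred
and uncorrelated: the constant and P - p* terms vanish, the perturbation term leaves a partial
derivative, and the O(h²) remainder, divided by h, vanishes. The indirect effect estimator thus
tends to -∇ȳᵀ A⁻¹ Δ = ∇ȳᵀ d.

Limits in probability are expressed as limits along `whp`, so limit algebra and squeezing apply
directly. Only outer measure enters, so the selection of P need not be measurable. -/

noncomputable section

/-! ### Convergence in probability as convergence along a filter -/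

/-- The filter of the events, for a sequence of experiments on one probability space, whose
probability tends to one. -/
def whp {Ω : Type*} [MeasurableSpace Ω] (μ : Measure Ω) : Filter (ℕ × Ω) where
  sets := {S | Tendsto (fun n => μ {ω | (n, ω) ∉ S}) atTop (𝓝 0)}
  univ_sets := by simp
  sets_of_superset {S T} hS hST := by
    refine tendsto_of_tendsto_of_tendsto_of_le_of_le tendsto_const_nhds hS (fun _ => zero_le) ?_
    intro n
    exact measure_mono fun ω hω h => hω (hST h)
  inter_sets {S T} hS hT := by
    have hadd := Tendsto.add hS hT
    rw [add_zero] at hadd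
    refine tendsto_of_tendsto_of_tendsto_of_le_of_le tendsto_const_nhds hadd
      (fun _ => zero_le) ?_
    intro n
    refine (measure_mono ?_).trans (measure_union_le _ _)
    intro ω hω
    by_contra hc
    simp only [Set.mem_union, Set.mem_ofPred_eq, not_or, not_not] at hc
    exact hω ⟨hc.1, hc.2⟩

section whp

variable {Ω : Type*} [MeasurableSpace Ω] {μ : Measure Ω}

lemma eventually_whp_iff {p : ℕ × Ω → Prop} :
    (∀ᶠ x in whp μ, p x) ↔ Tendsto (fun n => μ {ω | ¬ p (n, ω)}) atTop (𝓝 0) :=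
  Iff.rfl

lemma tendstoInMeasure_of_tendsto_whp {f : ℕ → Ω → ℝ} {c : ℝ}
    (h : Tendsto (fun x : ℕ × Ω => f x.1 x.2) (whp μ) (𝓝 c)) :
    TendstoInMeasure μ f atTop (fun _ => c) := by
  intro ε hε
  have h1 := EMetric.tendsto_nhds.1 h ε hε
  rw [eventually_whp_iff] at h1
  simpa only [not_lt] using h1

lemma tendsto_fst_whp : Tendsto Prod.fst (whp μ) atTop := by
  rw [tendsto_atTop]
  intro N
  rw [eventually_whp_iff]
  refine tendsto_const_nhds.congr' ?_
  filter_upwards [eventually_ge_atTop N] with n hn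
  simp [hn]

lemma eventually_whp_of_ae {p : ℕ → Ω → Prop} (h : ∀ᶠ n in atTop, ∀ᵐ ω ∂μ, p n ω) :
    ∀ᶠ x in whp μ, p x.1 x.2 := by
  rw [eventually_whp_iff]
  refine tendsto_const_nhds.congr' ?_
  filter_upwards [h] with n hn
  exact (ae_iff.1 hn).symm

end whp

/-! ### Chebyshev's inequality for bounded functions of an i.i.d. sample -/

lemma measure_pi_sum_sub_ge_le {Ξ : Type*} [MeasurableSpace Ξ] (ρ : Measure Ξ)
    [IsProbabilityMeasure ρ] {φ : Ξ → ℝ} (hm : Measurable φ) {C : ℝ}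
    (hb : ∀ᵐ ξ ∂ρ, |φ ξ| ≤ C) (n : ℕ) {t : ℝ} (ht : 0 < t) :
    Measure.pi (fun _ : Fin n => ρ) {x | t ≤ |∑ i, φ (x i) - n * ∫ ξ, φ ξ ∂ρ|} ≤
      ENNReal.ofReal (n * C ^ 2 / t ^ 2) := by
  have hL : MemLp φ 2 ρ := MemLp.of_bound hm.aestronglyMeasurable C hb
  have hcomp : ∀ i : Fin n, MemLp (fun x : Fin n → Ξ => φ (x i)) 2
      (Measure.pi (fun _ : Fin n => ρ)) := fun i =>
    hL.comp_measurePreserving (measurePreserving_eval (fun _ : Fin n => ρ) i)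
  have hsum : MemLp (fun x : Fin n → Ξ => ∑ i, φ (x i)) 2 (Measure.pi (fun _ : Fin n => ρ)) :=
    memLp_finsetSum _ fun i _ => hcomp i
  have hint : ∫ x, ∑ i, φ (x i) ∂(Measure.pi (fun _ : Fin n => ρ)) = n * ∫ ξ, φ ξ ∂ρ := by
    rw [integral_finsetSum _ fun i _ => (hcomp i).integrable (by norm_num)]
    have : ∀ i : Fin n, ∫ x : Fin n → Ξ, φ (x i) ∂(Measure.pi (fun _ : Fin n => ρ)) =
        ∫ ξ, φ ξ ∂ρ := fun i => integral_comp_eval hm.aestronglyMeasurable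
    simp [this]
  have hvar : variance (fun x : Fin n → Ξ => ∑ i, φ (x i)) (Measure.pi (fun _ : Fin n => ρ)) ≤
      n * C ^ 2 := by
    have h1 := variance_sum_pi (μ := fun _ : Fin n => ρ) (X := fun _ => φ) (fun _ => hL)
    have h2 : (∑ i : Fin n, fun x : Fin n → Ξ => φ (x i)) = fun x => ∑ i, φ (x i) := by
      ext x; simp
    rw [h2] at h1
    rw [h1]
    have h3 : variance φ ρ ≤ C ^ 2 := by
      refine (variance_le_expectation_sq hm.aestronglyMeasurable).trans ?_
      have : ∫ ξ, (φ ^ 2) ξ ∂ρ ≤ ∫ _, C ^ 2 ∂ρ := by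
        refine integral_mono_ae hL.integrable_sq (integrable_const _) ?_
        filter_upwards [hb] with ξ hξ
        exact sq_le_sq' (abs_le.1 hξ).1 (abs_le.1 hξ).2
      simpa using this
    simp only [Finset.sum_const, Finset.card_univ, Fintype.card_fin, nsmul_eq_mul]
    gcongr
  have hcheb := meas_ge_le_variance_div_sq hsum ht
  rw [hint] at hcheb
  refine hcheb.trans (ENNReal.ofReal_le_ofReal ?_)
  gcongr

/-- Weak law of large numbers for a triangular array. -/
lemma tendsto_whp_mul_sum_sub {Ω Ξ : Type*} [MeasurableSpace Ω] [MeasurableSpace Ξ]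
    {μ : Measure Ω} {ρ : ℕ → Measure Ξ} [∀ n, IsProbabilityMeasure (ρ n)]
    {ξ : (n : ℕ) → Ω → Fin n → Ξ} (hξ : ∀ n, HasLaw (ξ n) (Measure.pi fun _ : Fin n => ρ n) μ)
    {φ : ℕ → Ξ → ℝ} (hm : ∀ n, Measurable (φ n)) {C : ℝ}
    (hb : ∀ᶠ n in atTop, ∀ᵐ x ∂ρ n, |φ n x| ≤ C) {r : ℕ → ℝ}
    (hr : Tendsto (fun n : ℕ => n * r n ^ 2) atTop (𝓝 0)) :
    Tendsto (fun x : ℕ × Ω => r x.1 * (∑ i, φ x.1 (ξ x.1 x.2 i) - x.1 * ∫ y, φ x.1 y ∂ρ x.1))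
      (whp μ) (𝓝 0) := by
  rw [Metric.tendsto_nhds]
  intro ε hε
  rw [eventually_whp_iff]
  have hlim : Tendsto (fun n : ℕ => ENNReal.ofReal (n * r n ^ 2 * (C ^ 2 / ε ^ 2))) atTop (𝓝 0) := by
    have := ENNReal.tendsto_ofReal (hr.mul_const (C ^ 2 / ε ^ 2))
    simpa using this
  refine tendsto_of_tendsto_of_tendsto_of_le_of_le' tendsto_const_nhds hlim
    (Eventually.of_forall fun _ => zero_le) ?_
  filter_upwards [hb] with n hbn
  simp only [dist_zero_right, not_lt, Real.norm_eq_abs, abs_mul]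
  rcases eq_or_ne (r n) 0 with h0 | h0
  · simp [h0, hε.not_ge]
  have hrn : 0 < |r n| := abs_pos.2 h0
  have hset : MeasurableSet {x : Fin n → Ξ |
      ε ≤ |r n| * |∑ i, φ n (x i) - n * ∫ y, φ n y ∂ρ n|} := by
    have := hm n
    refine measurableSet_le measurable_const ?_
    fun_prop
  rw [(hξ n).measure_eq hset]
  refine (measure_mono ?_).trans ((measure_pi_sum_sub_ge_le (ρ n) (hm n) hbn n
    (div_pos hε hrn)).trans_eq ?_)
  · intro x hx
    simp only [Set.mem_ofPred_eq] at hx ⊢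
    rw [div_le_iff₀ hrn, mul_comm]
    exact hx
  · congr 1
    rw [div_pow, sq_abs]
    field_simp

/-! ### Uniformly smooth families of functions of the price -/

lemma clm_apply_eq_sum {J : ℕ} (T : Price J →L[ℝ] ℝ) (v : Price J) :
    T v = ∑ j, v j * T (EuclideanSpace.single j 1) := by
  conv_lhs => rw [← (EuclideanSpace.basisFun (Fin J) ℝ).sum_repr v]
  simp

/-- A family of functions of the price, measurable in the parameter, differentiable on `V`, with
values, derivatives and Lipschitz constants of the derivatives bounded by `C`. -/
structure SmoothFamily {J : ℕ} {X : Type*} [MeasurableSpace X] (F : X → Price J → ℝ)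
    (V : Set (Price J)) (C : ℝ) : Prop where
  measurable : ∀ p, Measurable fun x => F x p
  differentiableAt : ∀ x, ∀ p ∈ V, DifferentiableAt ℝ (F x) p
  bound : ∀ x, ∀ p ∈ V, |F x p| ≤ C
  bound_fderiv : ∀ x, ∀ p ∈ V, ‖fderiv ℝ (F x) p‖ ≤ C
  lipschitz_fderiv : ∀ x, ∀ p ∈ V, ∀ q ∈ V,
    ‖fderiv ℝ (F x) q - fderiv ℝ (F x) p‖ ≤ C * ‖q - p‖

namespace SmoothFamily

variable {J : ℕ} {X : Type*} [MeasurableSpace X] {F F' : X → Price J → ℝ} {V : Set (Price J)}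
  {C C' : ℝ}

lemma mono (h : SmoothFamily F V C) {V' : Set (Price J)} (hV : V' ⊆ V) : SmoothFamily F V' C where
  measurable := h.measurable
  differentiableAt x p hp := h.differentiableAt x p (hV hp)
  bound x p hp := h.bound x p (hV hp)
  bound_fderiv x p hp := h.bound_fderiv x p (hV hp)
  lipschitz_fderiv x p hp q hq := h.lipschitz_fderiv x p (hV hp) q (hV hq)

lemma nonneg [Nonempty X] (h : SmoothFamily F V C) {p : Price J} (hp : p ∈ V) : 0 ≤ C :=
  (abs_nonneg _).trans (h.bound (Classical.arbitrary X) p hp)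

lemma sub (h : SmoothFamily F V C) (h' : SmoothFamily F' V C') :
    SmoothFamily (fun x p => F x p - F' x p) V (C + C') where
  measurable p := (h.measurable p).sub (h'.measurable p)
  differentiableAt x p hp := (h.differentiableAt x p hp).sub (h'.differentiableAt x p hp)
  bound x p hp := (abs_sub _ _).trans (add_le_add (h.bound x p hp) (h'.bound x p hp))
  bound_fderiv x p hp := by
    rw [fderiv_fun_sub (h.differentiableAt x p hp) (h'.differentiableAt x p hp)]
    exact (norm_sub_le _ _).trans (add_le_add (h.bound_fderiv x p hp) (h'.bound_fderiv x p hp))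
  lipschitz_fderiv x p hp q hq := by
    rw [fderiv_fun_sub (h.differentiableAt x p hp) (h'.differentiableAt x p hp),
      fderiv_fun_sub (h.differentiableAt x q hq) (h'.differentiableAt x q hq), sub_sub_sub_comm,
      add_mul]
    exact (norm_sub_le _ _).trans
      (add_le_add (h.lipschitz_fderiv x p hp q hq) (h'.lipschitz_fderiv x p hp q hq))

lemma weight (h : SmoothFamily F V C) {a : X → ℝ} (ha : Measurable a) {A : ℝ}
    (hA : ∀ x, |a x| ≤ A) : SmoothFamily (fun x p => a x * F x p) V (A * C) where
  measurable p := ha.mul (h.measurable p)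
  differentiableAt x p hp := (h.differentiableAt x p hp).const_mul _
  bound x p hp := by
    rw [abs_mul]
    exact mul_le_mul (hA x) (h.bound x p hp) (abs_nonneg _) ((abs_nonneg _).trans (hA x))
  bound_fderiv x p hp := by
    rw [fderiv_const_mul (h.differentiableAt x p hp), norm_smul]
    exact mul_le_mul (hA x) (h.bound_fderiv x p hp) (norm_nonneg _) ((abs_nonneg _).trans (hA x))
  lipschitz_fderiv x p hp q hq := by
    rw [fderiv_const_mul (h.differentiableAt x p hp), fderiv_const_mul (h.differentiableAt x q hq),
      ← smul_sub, norm_smul, mul_assoc]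
    exact mul_le_mul (hA x) (h.lipschitz_fderiv x p hp q hq) (norm_nonneg _)
      ((abs_nonneg _).trans (hA x))

lemma comp {X' : Type*} [MeasurableSpace X'] (h : SmoothFamily F V C) {f : X' → X}
    (hf : Measurable f) : SmoothFamily (fun x => F (f x)) V C where
  measurable p := (h.measurable p).comp hf
  differentiableAt x := h.differentiableAt (f x)
  bound x := h.bound (f x)
  bound_fderiv x := h.bound_fderiv (f x)
  lipschitz_fderiv x := h.lipschitz_fderiv (f x)

lemma abs_sub_le (h : SmoothFamily F V C) (hV : Convex ℝ V) (x : X) {p q : Price J} (hp : p ∈ V)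
    (hq : q ∈ V) : |F x q - F x p| ≤ C * ‖q - p‖ :=
  hV.norm_image_sub_le_of_norm_fderiv_le (fun p hp => h.differentiableAt x p hp)
    (fun p hp => h.bound_fderiv x p hp) hp hq

/-- Along the segment the derivative deviates from its value at `p` by at most C‖q - p‖, so the mean
value inequality gives a quadratic remainder. The factor 1/2 is not needed. -/
lemma taylor [Nonempty X] (h : SmoothFamily F V C) (hV : Convex ℝ V) (x : X) {p q : Price J}
    (hp : p ∈ V) (hq : q ∈ V) :
    |F x q - F x p - fderiv ℝ (F x) p (q - p)| ≤ C * ‖q - p‖ ^ 2 := by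
  have hsub : segment ℝ p q ⊆ V := hV.segment_subset hp hq
  rw [pow_two, ← mul_assoc]
  refine (convex_segment p q).norm_image_sub_le_of_norm_fderiv_le'
    (fun y hy => h.differentiableAt x y (hsub hy)) (fun y hy => ?_)
    (left_mem_segment ℝ p q) (right_mem_segment ℝ p q)
  refine (h.lipschitz_fderiv x p hp y (hsub hy)).trans ?_
  have h0 := h.nonneg hp
  gcongr
  obtain ⟨t, ⟨ht0, ht1⟩, rfl⟩ := (segment_eq_image' ℝ p q ▸ hy :)
  rw [add_sub_cancel_left, norm_smul, Real.norm_of_nonneg ht0]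
  exact mul_le_of_le_one_left (norm_nonneg _) ht1

/-- A directional derivative is the limit of the difference quotients with step 1/n, and these are
measurable in the parameter even where the shifted price leaves `V`. -/
lemma measurable_fderiv_apply (h : SmoothFamily F V C) {p : Price J} (hp : p ∈ V) (v : Price J) :
    Measurable fun x => fderiv ℝ (F x) p v := by
  refine measurable_of_tendsto_metrizable
    (f := fun (n : ℕ) x => (n : ℝ) • (F x (p + (n : ℝ)⁻¹ • v) - F x p))
    (fun n => ((h.measurable _).sub (h.measurable _)).const_smul (n : ℝ)) ?_
  rw [tendsto_pi_nhds]
  intro x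
  exact ((h.differentiableAt x p hp).hasFDerivAt.lim_real v).comp tendsto_natCast_atTop_atTop

lemma stronglyMeasurable_fderiv (h : SmoothFamily F V C) {p : Price J} (hp : p ∈ V) :
    StronglyMeasurable fun x => fderiv ℝ (F x) p := by
  have heq : (fun x => fderiv ℝ (F x) p) = fun x =>
      ∑ j, fderiv ℝ (F x) p (EuclideanSpace.single j 1) •
        (EuclideanSpace.proj j : EuclideanSpace ℝ (Fin J) →L[ℝ] ℝ) := by
    ext x v
    rw [clm_apply_eq_sum]
    simp [mul_comm]
  rw [heq]
  exact Finset.stronglyMeasurable_fun_sum _ fun j _ =>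
    (h.measurable_fderiv_apply hp _).stronglyMeasurable.smul_const _

/-! ### Means of smooth families: differentiation under the integral -/

section mean

variable (ν : Measure X) [IsProbabilityMeasure ν]

lemma integrable (h : SmoothFamily F V C) {p : Price J} (hp : p ∈ V) :
    Integrable (fun x => F x p) ν :=
  Integrable.of_bound (h.measurable p).aestronglyMeasurable C (.of_forall fun x => h.bound x p hp)

lemma integrable_fderiv (h : SmoothFamily F V C) {p : Price J} (hp : p ∈ V) :
    Integrable (fun x => fderiv ℝ (F x) p) ν :=
  Integrable.of_bound (h.stronglyMeasurable_fderiv hp).aestronglyMeasurable C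
    (.of_forall fun x => h.bound_fderiv x p hp)

lemma hasFDerivAt_integral (h : SmoothFamily F V C) (hV : IsOpen V) {p : Price J} (hp : p ∈ V) :
    HasFDerivAt (fun p => ∫ x, F x p ∂ν) (∫ x, fderiv ℝ (F x) p ∂ν) p :=
  hasFDerivAt_integral_of_dominated_of_fderiv_le (bound := fun _ => C)
    (F' := fun p x => fderiv ℝ (F x) p) (hV.mem_nhds hp)
    (.of_forall fun p => (h.measurable p).aestronglyMeasurable) (h.integrable ν hp)
    (h.stronglyMeasurable_fderiv hp).aestronglyMeasurable
    (.of_forall fun x p hp => h.bound_fderiv x p hp) (integrable_const _)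
    (.of_forall fun x p hp => (h.differentiableAt x p hp).hasFDerivAt)

lemma fderiv_integral_apply (h : SmoothFamily F V C) (hV : IsOpen V) {p : Price J} (hp : p ∈ V)
    (v : Price J) :
    fderiv ℝ (fun p => ∫ x, F x p ∂ν) p v = ∫ x, fderiv ℝ (F x) p v ∂ν := by
  rw [(h.hasFDerivAt_integral ν hV hp).fderiv,
    ContinuousLinearMap.integral_apply (h.integrable_fderiv ν hp)]

lemma integral (h : SmoothFamily F V C) (hV : IsOpen V) :
    SmoothFamily (fun (_ : Unit) p => ∫ x, F x p ∂ν) V C where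
  measurable p := measurable_const
  differentiableAt _ p hp := (h.hasFDerivAt_integral ν hV hp).differentiableAt
  bound _ p hp := by
    have := norm_integral_le_of_norm_le_const (μ := ν) (f := fun x => F x p)
      (.of_forall fun x => h.bound x p hp)
    simpa using this
  bound_fderiv _ p hp := by
    rw [(h.hasFDerivAt_integral ν hV hp).fderiv]
    have := norm_integral_le_of_norm_le_const (μ := ν) (f := fun x => fderiv ℝ (F x) p)
      (.of_forall fun x => h.bound_fderiv x p hp)
    simpa using this
  lipschitz_fderiv _ p hp q hq := by
    rw [(h.hasFDerivAt_integral ν hV hp).fderiv, (h.hasFDerivAt_integral ν hV hq).fderiv,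
      ← integral_sub (h.integrable_fderiv ν hq) (h.integrable_fderiv ν hp)]
    have := norm_integral_le_of_norm_le_const (μ := ν)
      (f := fun x => fderiv ℝ (F x) q - fderiv ℝ (F x) p)
      (.of_forall fun x => h.lipschitz_fderiv x p hp q hq)
    simpa using this

end mean

lemma contDiffAt (h : SmoothFamily F V C) (hV : IsOpen V) (x : X)
    {p : Price J} (hp : p ∈ V) : ContDiffAt ℝ 1 (F x) p := by
  refine contDiffAt_one_iff.2 ⟨fderiv ℝ (F x), V, hV.mem_nhds hp, fun q hq => ?_,
    fun q hq => (h.differentiableAt x q hq).hasFDerivAt⟩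
  rw [ContinuousWithinAt, tendsto_iff_norm_sub_tendsto_zero]
  have hlim : Tendsto (fun q' => C * ‖q' - q‖) (𝓝[V] q) (𝓝 0) := by
    have : ContinuousWithinAt (fun q' : Price J => C * ‖q' - q‖) V q := by fun_prop
    simpa [ContinuousWithinAt] using this
  refine squeeze_zero' (.of_forall fun _ => norm_nonneg _) ?_ hlim
  filter_upwards [self_mem_nhdsWithin] with q' hq' using h.lipschitz_fderiv x q hq q' hq'

lemma mono_bound (h : SmoothFamily F V C) (hC : C ≤ C') : SmoothFamily F V C' where
  measurable := h.measurable
  differentiableAt := h.differentiableAt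
  bound x p hp := (h.bound x p hp).trans hC
  bound_fderiv x p hp := (h.bound_fderiv x p hp).trans hC
  lipschitz_fderiv x p hp q hq := (h.lipschitz_fderiv x p hp q hq).trans (by gcongr)

end SmoothFamily

/-- The scalar families obtained from a smooth bounded function of agent, treatment and price. -/
lemma Market.SmoothBounded.exists_smoothFamily {J : ℕ} {G E : Type*} [MeasurableSpace G]
    [NormedAddCommGroup E] [NormedSpace ℝ E] [MeasurableSpace E] [OpensMeasurableSpace E]
    {F : G → Bool → Price J → E} {O V : Set (Price J)} (h : Market.SmoothBounded F O)
    (hO : IsOpen O) (hVO : V ⊆ O) (hV : Convex ℝ V) (L : E →L[ℝ] ℝ) :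
    ∃ C, SmoothFamily (fun (x : G × Bool) p => L (F x.1 x.2 p)) V C := by
  obtain ⟨C, hC⟩ := h.bounded
  have hcd : ∀ (x : G × Bool), ∀ p ∈ O, ContDiffAt ℝ 2 (F x.1 x.2) p := fun x p hp =>
    (h.contDiffOn x.1 x.2).contDiffAt (hO.mem_nhds hp)
  have hcd' : ∀ (x : G × Bool), ∀ p ∈ O, ContDiffAt ℝ 2 (fun p => L (F x.1 x.2 p)) p :=
    fun x p hp => L.contDiff.contDiffAt.comp p (hcd x p hp)
  have hb : ∀ (x : G × Bool), ∀ p ∈ O, ∀ r ≤ 2,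
      ‖iteratedFDeriv ℝ r (fun p => L (F x.1 x.2 p)) p‖ ≤ ‖L‖ * C := by
    intro x p hp r hr
    have := L.iteratedFDeriv_comp_left (hcd x p hp) (i := r) (by exact_mod_cast hr)
    rw [Function.comp_def] at this
    rw [this]
    refine (ContinuousLinearMap.norm_compContinuousMultilinearMap_le _ _).trans ?_
    gcongr
    exact hC x.1 x.2 p hp r hr
  refine ⟨‖L‖ * C, ?_, ?_, ?_, ?_, ?_⟩
  · intro p
    refine measurable_from_prod_countable_left fun w => ?_
    exact L.continuous.measurable.comp (h.measurable w p)
  · exact fun x p hp => (hcd' x p (hVO hp)).differentiableAt (by norm_num)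
  · intro x p hp
    simpa using hb x p (hVO hp) 0 (by norm_num)
  · intro x p hp
    simpa [norm_iteratedFDeriv_one] using hb x p (hVO hp) 1 (by norm_num)
  -- The bound on the second derivative becomes a Lipschitz bound on the first, by the mean value
  -- inequality on the convex set `V`.
  · intro x p hp q hq
    refine hV.norm_image_sub_le_of_norm_fderiv_le (𝕜 := ℝ) (fun y hy => ?_) (fun y hy => ?_) hp hq
    · exact ((hcd' x y (hVO hy)).fderiv_right (m := 1) (by norm_num)).differentiableAt (by norm_num)
    · rw [← norm_iteratedFDeriv_one (𝕜 := ℝ) (fderiv ℝ fun p => L (F x.1 x.2 p)),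
        norm_iteratedFDeriv_fderiv]
      exact hb x y (hVO hy) 2 le_rfl

/-! ### The price box -/

lemma priceBox_eq_preimage {J : ℕ} (l u : Price J) :
    priceBox l u = (PiLp.continuousLinearEquiv 2 ℝ (fun _ : Fin J => ℝ)).toHomeomorph ⁻¹'
      Set.Icc (WithLp.ofLp l) (WithLp.ofLp u) := by
  ext p
  simp [priceBox, Pi.le_def, forall_and]

lemma isCompact_priceBox {J : ℕ} (l u : Price J) : IsCompact (priceBox l u) := by
  rw [priceBox_eq_preimage]
  exact (Homeomorph.isCompact_preimage _).2 isCompact_Icc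

lemma convex_priceBox {J : ℕ} (l u : Price J) : Convex ℝ (priceBox l u) := by
  intro p hp q hq a b ha hb hab j
  simp only [PiLp.add_apply, PiLp.smul_apply, smul_eq_mul]
  have h1 := hp j
  have h2 := hq j
  have ha' : b = 1 - a := by linarith
  subst ha'
  constructor <;> nlinarith

/-- The triangle inequality over coordinates; `J` in place of its square root is harmless because
the number of goods is fixed. -/
lemma norm_le_card_mul {J : ℕ} {v : Price J} {c : ℝ} (h : ∀ k, |v k| ≤ c) : ‖v‖ ≤ J * c := by
  have hv : v = ∑ j, v j • EuclideanSpace.single j (1 : ℝ) := by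
    conv_lhs => rw [← (EuclideanSpace.basisFun (Fin J) ℝ).sum_repr v]
    simp
  calc ‖v‖ = ‖∑ j, v j • EuclideanSpace.single j (1 : ℝ)‖ := by rw [← hv]
    _ ≤ ∑ j, ‖v j • EuclideanSpace.single j (1 : ℝ)‖ := norm_sum_le _ _
    _ ≤ ∑ _j : Fin J, c := Finset.sum_le_sum fun j _ => by simpa [norm_smul] using h j
    _ = J * c := by simp

lemma abs_apply_le_norm {J : ℕ} (v : Price J) (k : Fin J) : |v k| ≤ ‖v‖ :=
  PiLp.norm_apply_le v k

/-! ### Averages over agents and treatments -/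

lemma isProbabilityMeasure_treatmentLaw {π : ℝ} (h0 : 0 ≤ π) (h1 : π ≤ 1) :
    IsProbabilityMeasure (treatmentLaw π) := by
  constructor
  simp only [treatmentLaw, Measure.add_apply, Measure.smul_apply, measure_univ, smul_eq_mul,
    mul_one]
  rw [← ENNReal.ofReal_add h0 (by linarith)]
  simp

lemma integral_prod_treatmentLaw {G : Type*} [MeasurableSpace G] {Θ : Measure G}
    [IsProbabilityMeasure Θ] {π : ℝ} (h0 : 0 ≤ π) (h1 : π ≤ 1) {f : G × Bool → ℝ}
    (hf : Integrable f (Θ.prod (treatmentLaw π))) (hf' : ∀ w, Integrable (fun g => f (g, w)) Θ) :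
    ∫ x, f x ∂(Θ.prod (treatmentLaw π)) =
      π * ∫ g, f (g, true) ∂Θ + (1 - π) * ∫ g, f (g, false) ∂Θ := by
  have := isProbabilityMeasure_treatmentLaw h0 h1
  rw [integral_prod f hf]
  have h : ∀ g, ∫ w, f (g, w) ∂(treatmentLaw π) = π * f (g, true) + (1 - π) * f (g, false) := by
    intro g
    rw [treatmentLaw, integral_add_measure, integral_smul_measure, integral_smul_measure,
      integral_dirac, integral_dirac, ENNReal.toReal_ofReal h0,
      ENNReal.toReal_ofReal (by linarith), smul_eq_mul, smul_eq_mul]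
    · exact (integrable_dirac (by simp)).smul_measure (by simp)
    · exact (integrable_dirac (by simp)).smul_measure (by simp)
  simp_rw [h]
  rw [integral_add ((hf' true).const_mul _) ((hf' false).const_mul _), integral_const_mul,
    integral_const_mul]

/-- The weight of a treatment in the Horvitz–Thompson estimator. -/
def treatmentWeight (π : ℝ) (w : Bool) : ℝ :=
  (if w then 1 else 0) / π - (1 - if w then 1 else 0) / (1 - π)

namespace Market

variable {J : ℕ} {G : Type*} [MeasurableSpace G]

/-- Excess demand for good `k`, as a family indexed by agents and treatments. -/
def excess (M : Market J G) (k : Fin J) (x : G × Bool) (p : Price J) : ℝ := M.Z x.1 x.2 p k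

/-- Outcomes, as a family indexed by agents and treatments. -/
def outcome (M : Market J G) (x : G × Bool) (p : Price J) : ℝ := M.Y x.1 x.2 p

/-- Mean excess demand under treatment `w`. -/
def zCond (M : Market J G) (Θ : Measure G) (w : Bool) (p : Price J) : Price J :=
  M.d Θ w p - M.s Θ w p

/-- What the standing assumptions say on an open convex neighbourhood `V` of the price box. -/
structure Regular (M : Market J G) (Θ : Measure G) (l u : Price J) (π : ℝ) (V : Set (Price J))
    (C ρ : ℝ) : Prop where
  isOpen : IsOpen V
  convex : Convex ℝ V
  smooth_outcome : SmoothFamily M.outcome V C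
  smooth_excess : ∀ k, SmoothFamily (M.excess k) V C
  zCond_apply : ∀ w, ∀ p ∈ V, ∀ k, M.zCond Θ w p k = ∫ g, M.excess k (g, w) p ∂Θ
  lt_one : ρ < 1
  contraction : ∀ p ∈ V, ‖fderiv ℝ (fun q => M.z Θ π q + q) p‖ ≤ ρ

lemma contDiffAt_zCond {M : Market J G} {Θ : Measure G} [IsProbabilityMeasure Θ]
    {V : Set (Price J)} {C : ℝ}
    (hV : IsOpen V) (hs : ∀ k, SmoothFamily (M.excess k) V C)
    (hz : ∀ w, ∀ p ∈ V, ∀ k, M.zCond Θ w p k = ∫ g, M.excess k (g, w) p ∂Θ) (w : Bool)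
    {p : Price J} (hp : p ∈ V) : ContDiffAt ℝ 1 (M.zCond Θ w) p := by
  rw [contDiffAt_euclidean]
  intro k
  have h1 := (((hs k).comp (f := fun g : G => (g, w)) (by fun_prop)).integral Θ hV).contDiffAt
    hV () hp
  refine h1.congr_of_eventuallyEq ?_
  filter_upwards [hV.mem_nhds hp] with q hq using hz w q hq k

lemma contDiffAt_z {M : Market J G} {Θ : Measure G} {V : Set (Price J)}
    (h : ∀ w, ∀ p ∈ V, ContDiffAt ℝ 1 (M.zCond Θ w) p) (π : ℝ) {p : Price J} (hp : p ∈ V) :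
    ContDiffAt ℝ 1 (M.z Θ π) p :=
  ((h true p hp).const_smul π).add ((h false p hp).const_smul (1 - π))

lemma SmoothBounded.integrable {E : Type*} [NormedAddCommGroup E] [NormedSpace ℝ E]
    [MeasurableSpace E] [BorelSpace E] [SecondCountableTopology E] {F : G → Bool → Price J → E}
    {O : Set (Price J)} (h : SmoothBounded F O) (Θ : Measure G) [IsProbabilityMeasure Θ] (w : Bool)
    {p : Price J} (hp : p ∈ O) : Integrable (fun g => F g w p) Θ := by
  obtain ⟨C, hC⟩ := h.bounded
  refine Integrable.of_bound (h.measurable w p).aestronglyMeasurable C (.of_forall fun g => ?_)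
  simpa using hC g w p hp 0 (by norm_num)

/-- The box is compact and the derivative of `z_π` is continuous, so the strict bound on the box
becomes a uniform `ρ < 1` on a thickening. Room around the box is needed because agents face
perturbed prices. -/
lemma Assumptions.exists_regular {M : Market J G} {Θ : Measure G} [IsProbabilityMeasure Θ]
    {l u : Price J} {π : ℝ} (hM : M.Assumptions Θ l u π) :
    ∃ r C ρ, 0 < r ∧ M.Regular Θ l u π (Metric.thickening r (priceBox l u)) C ρ := by
  obtain ⟨O, hO, hbox, hY, hD, hS⟩ := hM.smooth
  have hcpt := isCompact_priceBox l u
  have hconv := convex_priceBox l u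
  obtain ⟨r₀, hr₀, hr₀O⟩ := hcpt.exists_thickening_subset_open hO hbox
  set V₀ := Metric.thickening r₀ (priceBox l u) with hV₀
  have hV₀o : IsOpen V₀ := Metric.isOpen_thickening
  have hV₀c : Convex ℝ V₀ := hconv.thickening r₀
  obtain ⟨C₁, hC₁⟩ := hY.exists_smoothFamily hO hr₀O hV₀c (ContinuousLinearMap.id ℝ ℝ)
  have hexD := fun k => hD.exists_smoothFamily hO hr₀O hV₀c
    (EuclideanSpace.proj k : EuclideanSpace ℝ (Fin J) →L[ℝ] ℝ)
  have hexS := fun k => hS.exists_smoothFamily hO hr₀O hV₀c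
    (EuclideanSpace.proj k : EuclideanSpace ℝ (Fin J) →L[ℝ] ℝ)
  choose C₂ hC₂ using hexD
  choose C₃ hC₃ using hexS
  have hsZ : ∀ k, SmoothFamily (M.excess k) V₀ (C₂ k + C₃ k) := fun k => (hC₂ k).sub (hC₃ k)
  obtain ⟨C₄, hC₄⟩ := (Set.finite_range fun k => C₂ k + C₃ k).bddAbove
  have hsZ' : ∀ k, SmoothFamily (M.excess k) V₀ (max C₁ C₄) := fun k =>
    (hsZ k).mono_bound ((hC₄ ⟨k, rfl⟩).trans (le_max_right _ _))
  have hzc : ∀ w, ∀ p ∈ V₀, ∀ k, M.zCond Θ w p k = ∫ g, M.excess k (g, w) p ∂Θ := by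
    intro w p hp k
    have h1 := hD.integrable Θ w (hr₀O hp)
    have h2 := hS.integrable Θ w (hr₀O hp)
    rw [zCond, d, s, ← integral_sub h1 h2]
    exact ((EuclideanSpace.proj k : EuclideanSpace ℝ (Fin J) →L[ℝ] ℝ).integral_comp_comm
      (h1.sub h2)).symm
  have hcd : ∀ w, ∀ p ∈ V₀, ContDiffAt ℝ 1 (M.zCond Θ w) p := fun w p hp =>
    contDiffAt_zCond hV₀o hsZ' hzc w hp
  have hbox₀ : priceBox l u ⊆ V₀ := Metric.self_subset_thickening hr₀ _
  have hcont : ContinuousOn (fun p => ‖fderiv ℝ (fun q => M.z Θ π q + q) p‖) V₀ := by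
    intro p hp
    refine ContinuousAt.continuousWithinAt (ContinuousAt.norm ?_)
    exact (((contDiffAt_z hcd π hp).add contDiffAt_id).fderiv_right (m := 0) (by norm_num)).continuousAt
  obtain ⟨ρ, hρ1, hρ⟩ : ∃ ρ < 1, ∀ p ∈ priceBox l u,
      ‖fderiv ℝ (fun q => M.z Θ π q + q) p‖ < ρ := by
    rcases (priceBox l u).eq_empty_or_nonempty with he | hne
    · exact ⟨0, one_pos, by simp [he]⟩
    · obtain ⟨p, hp, hmax⟩ := hcpt.exists_isMaxOn hne (hcont.mono hbox₀)
      obtain ⟨ρ, h1, h2⟩ := exists_between (hM.contraction p hp)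
      exact ⟨ρ, h2, fun q hq => (hmax hq).trans_lt h1⟩
  have hopen := hcont.isOpen_inter_preimage hV₀o (isOpen_Iio (a := ρ))
  obtain ⟨r, hr, hrV⟩ := hcpt.exists_thickening_subset_open hopen
    (fun p hp => ⟨hbox₀ hp, hρ p hp⟩)
  have hVV : Metric.thickening r (priceBox l u) ⊆ V₀ := fun p hp => (hrV hp).1
  exact ⟨r, max C₁ C₄, ρ, hr, Metric.isOpen_thickening, hconv.thickening r,
    (hC₁.mono_bound (le_max_left _ _)).mono hVV, fun k => (hsZ' k).mono hVV,
    fun w p hp k => hzc w p (hVV hp) k, hρ1, fun p hp => (hrV hp).2.le⟩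

end Market

/-! ### Uniform law of large numbers -/

/-- A finite net suffices: sample averages and the mean share the Lipschitz constant `C`, so a large
deviation somewhere in `T` forces one at a centre of the net, where Chebyshev applies. -/
lemma SmoothFamily.exists_measure_pi_le {J : ℕ} {X : Type*} [MeasurableSpace X]
    {F : X → Price J → ℝ} {V : Set (Price J)} {C : ℝ} (h : SmoothFamily F V C) (hV : Convex ℝ V)
    (hVo : IsOpen V) (ν : Measure X) [IsProbabilityMeasure ν] {T : Set (Price J)}
    (hT : IsCompact T) (hTV : T ⊆ V) {ε : ℝ} (hε : 0 < ε) :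
    ∃ B : ℝ, ∀ n : ℕ, 0 < n → Measure.pi (fun _ : Fin n => ν)
      {x | ∃ p ∈ T, ε ≤ |(n : ℝ)⁻¹ * ∑ i, F (x i) p - ∫ y, F y p ∂ν|} ≤ ENNReal.ofReal (B / n) := by
  rcases T.eq_empty_or_nonempty with rfl | ⟨p₀, hp₀⟩
  · exact ⟨0, by simp⟩
  have := ν.nonempty_of_neZero
  have hC := h.nonneg (hTV hp₀)
  -- At this radius both the average and the mean move by at most ε/4 between a point and its
  -- centre, which leaves a deviation of ε/2 at the centre. The `+ 1` guards against `C = 0`.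
  obtain ⟨t, htT, htf, hcov⟩ := hT.finite_cover_balls (e := ε / (4 * (C + 1))) (by positivity)
  refine ⟨htf.toFinset.card * (4 * C ^ 2 / ε ^ 2), fun n hn => ?_⟩
  have hn' : (0 : ℝ) < n := by exact_mod_cast hn
  have hsub : {x : Fin n → X | ∃ p ∈ T, ε ≤ |(n : ℝ)⁻¹ * ∑ i, F (x i) p - ∫ y, F y p ∂ν|} ⊆
      ⋃ c ∈ htf.toFinset, {x | n * (ε / 2) ≤ |∑ i, F (x i) c - n * ∫ y, F y c ∂ν|} := by
    rintro x ⟨p, hp, hx⟩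
    obtain ⟨c, hc, hpc⟩ : ∃ c ∈ t, ‖p - c‖ < ε / (4 * (C + 1)) := by
      simpa [dist_eq_norm] using hcov hp
    have hCpc : C * ‖p - c‖ ≤ ε / 4 := by
      rw [lt_div_iff₀ (by positivity)] at hpc
      nlinarith [norm_nonneg (p - c)]
    simp only [Set.mem_iUnion, Set.mem_ofPred_eq, htf.mem_toFinset]
    refine ⟨c, hc, ?_⟩
    have h1 : |(n : ℝ)⁻¹ * ∑ i, F (x i) p - (n : ℝ)⁻¹ * ∑ i, F (x i) c| ≤ ε / 4 := by
      rw [← mul_sub, ← Finset.sum_sub_distrib, abs_mul, abs_of_pos (inv_pos.2 hn'),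
        inv_mul_le_iff₀ hn']
      refine (Finset.abs_sum_le_sum_abs _ _).trans ?_
      refine (Finset.sum_le_card_nsmul _ _ (ε / 4) fun i _ =>
        (h.abs_sub_le hV (x i) (hTV (htT hc)) (hTV hp)).trans hCpc).trans ?_
      simp
    have h2 : |∫ y, F y p ∂ν - ∫ y, F y c ∂ν| ≤ ε / 4 :=
      ((h.integral ν hVo).abs_sub_le hV () (hTV (htT hc)) (hTV hp)).trans hCpc
    have h3 : ε / 2 ≤ |(n : ℝ)⁻¹ * ∑ i, F (x i) c - ∫ y, F y c ∂ν| := by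
      rw [abs_le] at h1 h2
      rcases le_abs.1 hx with h4 | h4
      · exact le_abs.2 (Or.inl (by linarith))
      · exact le_abs.2 (Or.inr (by linarith))
    have h4 : ∑ i, F (x i) c - n * ∫ y, F y c ∂ν =
        n * ((n : ℝ)⁻¹ * ∑ i, F (x i) c - ∫ y, F y c ∂ν) := by
      field_simp
    rw [h4, abs_mul, abs_of_pos hn']
    gcongr
  refine (measure_mono hsub).trans ((measure_biUnion_finset_le _ _).trans ?_)
  have hone : ∀ c ∈ htf.toFinset, Measure.pi (fun _ : Fin n => ν)
      {x | n * (ε / 2) ≤ |∑ i, F (x i) c - n * ∫ y, F y c ∂ν|} ≤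
      ENNReal.ofReal (4 * C ^ 2 / ε ^ 2 / n) := by
    intro c hc
    refine (measure_pi_sum_sub_ge_le ν (h.measurable c) (C := C)
      (.of_forall fun x => h.bound x c (hTV (htT (htf.mem_toFinset.1 hc)))) n
      (t := n * (ε / 2)) (by positivity)).trans_eq ?_
    congr 1
    field_simp
    ring
  refine (Finset.sum_le_card_nsmul _ _ _ hone).trans_eq ?_
  rw [nsmul_eq_mul, mul_div_assoc (htf.toFinset.card : ℝ), ENNReal.ofReal_mul (by positivity), ENNReal.ofReal_natCast]

namespace Market

variable {J : ℕ} {G : Type*} [MeasurableSpace G]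

/-! ### The mean-field market -/

/-- Excess demand is affine in the treatment probability, so bounds on `z_π` transfer to nearby
probabilities. -/
lemma z_eq_add_smul (M : Market J G) (Θ : Measure G) (π q : ℝ) (p : Price J) :
    M.z Θ q p = M.z Θ π p + (q - π) • (M.zCond Θ true p - M.zCond Θ false p) := by
  simp only [z, zCond]
  module

/-! ### Uniqueness, existence, interiority and differentiability of the mean-field price -/

namespace Regular

variable {M : Market J G} {Θ : Measure G} [IsProbabilityMeasure Θ] {l u : Price J} {π : ℝ}
  {V : Set (Price J)} {C ρ : ℝ}

lemma contDiffAt_zCond (h : M.Regular Θ l u π V C ρ) (w : Bool) {p : Price J} (hp : p ∈ V) :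
    ContDiffAt ℝ 1 (M.zCond Θ w) p :=
  Market.contDiffAt_zCond h.isOpen h.smooth_excess h.zCond_apply w hp

lemma contDiffAt_z (h : M.Regular Θ l u π V C ρ) (q : ℝ) {p : Price J} (hp : p ∈ V) :
    ContDiffAt ℝ 1 (M.z Θ q) p :=
  Market.contDiffAt_z (fun w _ hp => h.contDiffAt_zCond w hp) q hp

/-- With f = z_π + id, one has p - q = (f p - f q) - (z_π p - z_π q), and f is a ρ-contraction on
the convex set `V`. -/
lemma le_norm_z_sub (h : M.Regular Θ l u π V C ρ) {p q : Price J} (hp : p ∈ V) (hq : q ∈ V) :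
    (1 - ρ) * ‖p - q‖ ≤ ‖M.z Θ π p - M.z Θ π q‖ := by
  have h1 := h.convex.norm_image_sub_le_of_norm_fderiv_le (𝕜 := ℝ)
    (f := fun q => M.z Θ π q + q) (C := ρ)
    (fun y hy => ((h.contDiffAt_z π hy).differentiableAt (by norm_num)).add differentiableAt_id)
    h.contraction hq hp
  have h2 : p - q = (M.z Θ π p + p - (M.z Θ π q + q)) - (M.z Θ π p - M.z Θ π q) := by abel
  have h3 := norm_sub_le (M.z Θ π p + p - (M.z Θ π q + q)) (M.z Θ π p - M.z Θ π q)
  rw [← h2] at h3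
  linarith

lemma norm_zCond_sub_le (h : M.Regular Θ l u π V C ρ) (w : Bool) {p q : Price J} (hp : p ∈ V)
    (hq : q ∈ V) : ‖M.zCond Θ w p - M.zCond Θ w q‖ ≤ J * (C * ‖p - q‖) := by
  refine norm_le_card_mul fun k => ?_
  rw [PiLp.sub_apply, h.zCond_apply w p hp, h.zCond_apply w q hq]
  exact (((h.smooth_excess k).comp (f := fun g : G => (g, w)) (by fun_prop)).integral Θ
    h.isOpen).abs_sub_le h.convex () hq hp

/-- For treatment probabilities close to `π`, at most one price clears the market. -/
lemma eventually_unique (h : M.Regular Θ l u π V C ρ) :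
    ∀ᶠ q in 𝓝 π, ∀ p ∈ V, ∀ p' ∈ V, M.z Θ q p = 0 → M.z Θ q p' = 0 → p = p' := by
  -- At two zeros of `z_q` the values of `z_π` differ by |q - π| times an increment of treated minus
  -- control excess demand, which has Lipschitz constant at most 2JC. Once this product is below 1 -
  -- ρ, `le_norm_z_sub` is violated unless the zeros agree.
  have hlim : Tendsto (fun q => |q - π| * (2 * (J * C))) (𝓝 π) (𝓝 0) := by
    have : ContinuousAt (fun q => |q - π| * (2 * (J * C))) π := by fun_prop
    simpa [ContinuousAt] using this
  filter_upwards [hlim.eventually_lt_const (sub_pos.2 h.lt_one)] with q hq p hp p' hp' hz hz'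
  by_contra hne
  have hpos : 0 < ‖p - p'‖ := norm_pos_iff.2 (sub_ne_zero.2 hne)
  have h1 := h.le_norm_z_sub hp hp'
  rw [z_eq_add_smul M Θ π q] at hz hz'
  have h2 : M.z Θ π p - M.z Θ π p' = -(q - π) • ((M.zCond Θ true p - M.zCond Θ true p') -
      (M.zCond Θ false p - M.zCond Θ false p')) := by
    rw [eq_neg_of_add_eq_zero_left hz, eq_neg_of_add_eq_zero_left hz']
    module
  rw [h2, norm_smul, norm_neg, Real.norm_eq_abs] at h1
  have h3 := (norm_sub_le (M.zCond Θ true p - M.zCond Θ true p')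
    (M.zCond Θ false p - M.zCond Θ false p')).trans
    (add_le_add (h.norm_zCond_sub_le true hp hp') (h.norm_zCond_sub_le false hp hp'))
  have h4 := mul_le_mul_of_nonneg_left h3 (abs_nonneg (q - π))
  have h5 := mul_lt_mul_of_pos_right hq hpos
  linarith

lemma integrable_excess (h : M.Regular Θ l u π V C ρ) (w : Bool) (k : Fin J) {p : Price J}
    (hp : p ∈ V) : Integrable (fun g => M.excess k (g, w) p) Θ :=
  ((h.smooth_excess k).comp (f := fun g : G => (g, w)) (by fun_prop)).integrable Θ hp

lemma z_apply (h : M.Regular Θ l u π V C ρ) (h0 : 0 ≤ π) (h1 : π ≤ 1) {p : Price J} (hp : p ∈ V)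
    (k : Fin J) : M.z Θ π p k = ∫ x, M.excess k x p ∂(Θ.prod (treatmentLaw π)) := by
  have := isProbabilityMeasure_treatmentLaw h0 h1
  rw [integral_prod_treatmentLaw h0 h1 ((h.smooth_excess k).integrable _ hp)
    fun w => h.integrable_excess w k hp, ← h.zCond_apply true p hp, ← h.zCond_apply false p hp]
  rfl

/-- Market clearing in large finite markets, with the constant price perturbation `v`, forces the
mean-field excess demand to vanish at a price of the perturbed box. -/
lemma exists_z_add_eq_zero (h : M.Regular Θ l u π V C ρ) (h0 : 0 ≤ π) (h1 : π ≤ 1) {v : Price J}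
    (hv : ∀ p ∈ priceBox l u, p + v ∈ V) {a : ℕ → ℝ} (ha : Tendsto a atTop (𝓝 0))
    (hclear : Tendsto (fun n : ℕ =>
        Measure.pi (fun _ : Fin n => Θ.prod (treatmentLaw π))
          {x | ¬ ∃ p ∈ priceBox l u,
            ‖M.avgExcess (fun i => (x i).1) (fun i => (x i).2)
              (fun (_ : Fin n) (j : Fin J) => v j) p‖ ≤ a n})
        atTop (𝓝 0)) :
    ∃ p ∈ priceBox l u, M.z Θ π (p + v) = 0 := by
  have := isProbabilityMeasure_treatmentLaw h0 h1
  set ν := Θ.prod (treatmentLaw π) with hν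
  have hcpt := isCompact_priceBox l u
  have hT : IsCompact ((fun p => p + v) '' priceBox l u) := hcpt.image (by fun_prop)
  have hTV : (fun p => p + v) '' priceBox l u ⊆ V := by
    rintro _ ⟨p, hp, rfl⟩
    exact hv p hp
  have key : ∀ ε > 0, ∃ p ∈ priceBox l u, ‖M.z Θ π (p + v)‖ ≤ ε := by
    intro ε hε
    -- The clearing error takes ε/2, and the `J` coordinatewise deviations of size δ together take
    -- at most another ε/2.
    set δ := ε / (2 * (J + 1)) with hδ
    have hδ0 : 0 < δ := by positivity
    have hex := fun k => (h.smooth_excess k).exists_measure_pi_le h.convex h.isOpen ν hT hTV hδ0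
    choose B hB using hex
    have hlimB : ∀ k, Tendsto (fun n : ℕ => Measure.pi (fun _ : Fin n => ν)
        {x | ∃ p ∈ (fun p => p + v) '' priceBox l u,
          δ ≤ |(n : ℝ)⁻¹ * ∑ i, M.excess k (x i) p - ∫ y, M.excess k y p ∂ν|}) atTop (𝓝 0) := by
      intro k
      have : Tendsto (fun n : ℕ => ENNReal.ofReal (B k / n)) atTop (𝓝 0) := by
        have := ENNReal.tendsto_ofReal (tendsto_const_div_atTop_nhds_zero_nat (B k))
        simpa using this
      refine tendsto_of_tendsto_of_tendsto_of_le_of_le' tendsto_const_nhds this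
        (.of_forall fun _ => zero_le) ?_
      filter_upwards [eventually_gt_atTop 0] with n hn using hB k n hn
    have hsum := hclear.add (tendsto_finsetSum Finset.univ fun k _ => hlimB k)
    simp only [Finset.sum_const_zero, add_zero] at hsum
    obtain ⟨n, hn1, hn2⟩ := ((hsum.eventually_lt_const zero_lt_one).and
      (ha.eventually_le_const (half_pos hε))).exists
    -- For this n the bad events have total probability below one, so some sample avoids all of
    -- them; the resulting bound on `z_π` is deterministic.
    obtain ⟨x, hx⟩ : ∃ x : Fin n → G × Bool, x ∉ {x | ¬ ∃ p ∈ priceBox l u,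
            ‖M.avgExcess (fun i => (x i).1) (fun i => (x i).2)
              (fun (_ : Fin n) (j : Fin J) => v j) p‖ ≤ a n} ∪
        ⋃ k ∈ (Finset.univ : Finset (Fin J)), {x | ∃ p ∈ (fun p => p + v) '' priceBox l u,
          δ ≤ |(n : ℝ)⁻¹ * ∑ i, M.excess k (x i) p - ∫ y, M.excess k y p ∂ν|} := by
      by_contra hcon
      have hall := fun x => not_not.1 (not_exists.1 hcon x)
      have huniv := (measure_mono (μ := Measure.pi (fun _ : Fin n => ν))
        (fun x _ => hall x : Set.univ ⊆ _)).trans ((measure_union_le _ _).trans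
          (add_le_add_right (measure_biUnion_finset_le _ _) _))
      rw [measure_univ] at huniv
      exact absurd hn1 (not_lt.2 huniv)
    obtain ⟨hx1, hx2⟩ := not_or.1 hx
    simp only [Set.mem_iUnion, Set.mem_ofPred_eq, Finset.mem_univ, exists_true_left,
      not_exists, not_and, not_le] at hx2
    obtain ⟨p, hp, hpa⟩ := not_not.1 hx1
    refine ⟨p, hp, ?_⟩
    have hdiff : ‖M.avgExcess (fun i => (x i).1) (fun i => (x i).2)
        (fun (_ : Fin n) (j : Fin J) => v j) p - M.z Θ π (p + v)‖ ≤ J * δ := by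
      refine norm_le_card_mul fun k => ?_
      have := (hx2 k (p + v) ⟨p, hp, rfl⟩).le
      rw [← h.z_apply h0 h1 (hv p hp)] at this
      simpa [avgExcess, excess, facedPrice] using this
    have hJδ : J * δ ≤ ε / 2 := by
      rw [hδ, mul_div_assoc', div_le_div_iff₀ (by positivity) two_pos]
      nlinarith
    have h3 := norm_sub_norm_le (M.z Θ π (p + v)) (M.avgExcess (fun i => (x i).1)
      (fun i => (x i).2) (fun (_ : Fin n) (j : Fin J) => v j) p)
    rw [norm_sub_rev] at h3
    linarith
  obtain ⟨p₁, hp₁, -⟩ := key 1 one_pos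
  have hcont : ContinuousOn (fun p => ‖M.z Θ π (p + v)‖) (priceBox l u) := fun p hp => by
    have h2 : ContinuousAt (M.z Θ π) (p + v) := (h.contDiffAt_z π (hv p hp)).continuousAt
    have h3 : ContinuousAt (fun p : Price J => p + v) p := by fun_prop
    exact (ContinuousAt.comp (f := fun p : Price J => p + v) h2 h3).norm.continuousWithinAt
  -- The minimum of the norm is attained on the compact box and lies below every ε, hence is zero.
  obtain ⟨p, hp, hmin⟩ := hcpt.exists_isMinOn ⟨p₁, hp₁⟩ hcont
  refine ⟨p, hp, norm_le_zero_iff.1 (le_of_forall_pos_le_add fun ε hε => ?_)⟩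
  obtain ⟨q, hq, hqε⟩ := key ε hε
  have := hmin hq
  simp only [Set.mem_ofPred_eq] at this
  linarith

/-- The mean-field price exists, and it lies in the interior of the price box. -/
lemma isMeanFieldPrice_pStar {r : ℝ} (hr : 0 < r)
    (h : M.Regular Θ l u π (Metric.thickening r (priceBox l u)) C ρ) (h0 : 0 ≤ π) (h1 : π ≤ 1)
    (hM : M.Assumptions Θ l u π) :
    M.IsMeanFieldPrice Θ l u π (M.pStar Θ l u π) ∧
      M.pStar Θ l u π ∈ interior (priceBox l u) := by
  obtain ⟨B, hB, a, ha, hclear⟩ := hM.approx_clearing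
  have ha0 : Tendsto a atTop (𝓝 0) := by
    have := ha.mul tendsto_inv_atTop_nhds_zero_nat
    rw [zero_mul] at this
    refine this.congr' ?_
    filter_upwards [eventually_gt_atTop 0] with n hn
    have : (n : ℝ) ≠ 0 := by positivity
    field_simp
  have hsub : priceBox l u ⊆ Metric.thickening r (priceBox l u) :=
    Metric.self_subset_thickening hr _
  have hv : ∀ v : Price J, ‖v‖ < r → ∀ p ∈ priceBox l u,
      p + v ∈ Metric.thickening r (priceBox l u) := fun v hvr p hp =>
    Metric.mem_thickening_iff.2 ⟨p, hp, by simpa [dist_eq_norm] using hvr⟩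
  have hex : ∀ v : Price J, ‖v‖ < min B r → ∃ p ∈ priceBox l u, M.z Θ π (p + v) = 0 :=
    fun v hvr => h.exists_z_add_eq_zero h0 h1 (hv v (hvr.trans_le (min_le_right _ _))) ha0
      (hclear _ fun _ _ j => (abs_apply_le_norm v j).trans (hvr.le.trans (min_le_left _ _)))
  have hpos : 0 < min B r := lt_min hB hr
  have hstar : M.IsMeanFieldPrice Θ l u π (M.pStar Θ l u π) := by
    obtain ⟨p, hp, hz⟩ := hex 0 (by simpa using hpos)
    exact Classical.epsilon_spec (p := M.IsMeanFieldPrice Θ l u π) ⟨p, hp, by simpa using hz⟩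
  refine ⟨hstar, mem_interior_iff_mem_nhds.2 ?_⟩
  -- For `p` near p*, the perturbation v = p* - p yields `q` in the box with `q + v` a zero.
  -- Uniqueness on the thickening gives q + v = p*, so `q = p`.
  filter_upwards [Metric.ball_mem_nhds (M.pStar Θ l u π) hpos] with p hp
  rw [Metric.mem_ball, dist_comm, dist_eq_norm] at hp
  obtain ⟨q, hq, hz⟩ := hex _ hp
  have huniq := h.eventually_unique.self_of_nhds _
    (hv _ (hp.trans_le (min_le_right _ _)) q hq) _ (hsub hstar.1) hz hstar.2
  have : q = p := by
    have h2 : q = M.pStar Θ l u π - (M.pStar Θ l u π - p) := eq_sub_of_add_eq huniq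
    simpa using h2
  exact this ▸ hq

/-- Existence, uniqueness and differentiability of the mean-field price for treatment
probabilities close to `π`. -/
lemma hasDerivAt_pStar (h : M.Regular Θ l u π V C ρ) (hbox : priceBox l u ⊆ V)
    (hz : M.z Θ π (M.pStar Θ l u π) = 0) (hint : M.pStar Θ l u π ∈ interior (priceBox l u))
    (hbij : Function.Bijective (fderiv ℝ (M.z Θ π) (M.pStar Θ l u π))) :
    (∀ᶠ q in 𝓝 π, ∃! p, M.IsMeanFieldPrice Θ l u q p) ∧
    ∃ d : Price J, HasDerivAt (M.pStar Θ l u) d π ∧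
      fderiv ℝ (M.z Θ π) (M.pStar Θ l u π) d =
        -(M.zCond Θ true (M.pStar Θ l u π) - M.zCond Θ false (M.pStar Θ l u π)) := by
  set p₀ := M.pStar Θ l u π with hp₀
  have hp₀V : p₀ ∈ V := hbox (interior_subset hint)
  set A := fderiv ℝ (M.z Θ π) p₀ with hA
  set Δ : Price J → Price J := fun p => M.zCond Θ true p - M.zCond Θ false p with hΔ
  have hAs : HasStrictFDerivAt (M.z Θ π) A p₀ := (h.contDiffAt_z π hp₀V).hasStrictFDerivAt (by norm_num)
  have hΔs : HasStrictFDerivAt Δ (fderiv ℝ Δ p₀) p₀ :=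
    ((h.contDiffAt_zCond true hp₀V).sub (h.contDiffAt_zCond false hp₀V)).hasStrictFDerivAt
      (by norm_num)
  have hjoint : HasStrictFDerivAt (fun x : ℝ × Price J => M.z Θ x.1 x.2)
      (A.comp (ContinuousLinearMap.snd ℝ ℝ (Price J)) +
        (ContinuousLinearMap.fst ℝ ℝ (Price J)).smulRight (Δ p₀)) (π, p₀) := by
    have h1 : HasStrictFDerivAt (fun x : ℝ × Price J => M.z Θ π x.2)
        (A.comp (ContinuousLinearMap.snd ℝ ℝ (Price J))) (π, p₀) :=
      HasStrictFDerivAt.comp (g := M.z Θ π) (f := Prod.snd) (π, p₀) hAs hasStrictFDerivAt_snd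
    have h2 : HasStrictFDerivAt (fun x : ℝ × Price J => Δ x.2)
        ((fderiv ℝ Δ p₀).comp (ContinuousLinearMap.snd ℝ ℝ (Price J))) (π, p₀) :=
      HasStrictFDerivAt.comp (g := Δ) (f := Prod.snd) (π, p₀) hΔs hasStrictFDerivAt_snd
    have h3 : HasStrictFDerivAt (fun x : ℝ × Price J => x.1 - π)
        (ContinuousLinearMap.fst ℝ ℝ (Price J)) (π, p₀) := hasStrictFDerivAt_fst.sub_const π
    -- In the product rule the factor `x.1 - π` vanishes at the base point, so the derivative of `Δ`
    -- drops out.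
    have h4 := h1.add (h3.smul h2)
    simp only [sub_self, zero_smul, zero_add] at h4
    refine h4.congr_of_eventuallyEq (.of_forall fun x => ?_)
    exact (z_eq_add_smul M Θ π x.1 x.2).symm
  have hinv : ((A.comp (ContinuousLinearMap.snd ℝ ℝ (Price J)) +
        (ContinuousLinearMap.fst ℝ ℝ (Price J)).smulRight (Δ p₀)).comp
        (ContinuousLinearMap.inr ℝ ℝ (Price J))).IsInvertible := by
    refine ⟨ContinuousLinearEquiv.ofBijective A (LinearMap.ker_eq_bot.2 hbij.1)
      (LinearMap.range_eq_top.2 hbij.2), ?_⟩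
    ext v : 1
    simp
  set g := hjoint.implicitFunctionOfProdDomain hinv with hg
  have hgs := hjoint.hasStrictFDerivAt_implicitFunctionOfProdDomain hinv
  have hgt : Tendsto g (𝓝 π) (𝓝 p₀) := hjoint.tendsto_implicitFunctionOfProdDomain hinv
  have hgz := hjoint.eventually_apply_implicitFunctionOfProdDomain hinv
  have hgbox : ∀ᶠ q in 𝓝 π, M.IsMeanFieldPrice Θ l u q (g q) := by
    filter_upwards [hgz, hgt (mem_interior_iff_mem_nhds.1 hint)] with q h1 h2
    exact ⟨h2, h1.trans hz⟩
  -- The implicit function stays in the box because `p₀` is interior. Its values show that the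
  -- choice defining `pStar` picks a genuine zero, and uniqueness identifies the two.
  have heq : M.pStar Θ l u =ᶠ[𝓝 π] g := by
    filter_upwards [hgbox, h.eventually_unique] with q h1 h2
    have h3 : M.IsMeanFieldPrice Θ l u q (M.pStar Θ l u q) :=
      Classical.epsilon_spec (p := M.IsMeanFieldPrice Θ l u q) ⟨g q, h1⟩
    exact h2 _ (hbox h3.1) _ (hbox h1.1) h3.2 h1.2
  refine ⟨?_, ?_⟩
  · filter_upwards [hgbox, h.eventually_unique] with q h1 h2
    exact ⟨g q, h1, fun p hp => h2 _ (hbox hp.1) _ (hbox h1.1) hp.2 h1.2⟩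
  · have hd : DifferentiableAt ℝ (M.pStar Θ l u) π :=
      (heq.differentiableAt_iff).2 hgs.hasFDerivAt.differentiableAt
    refine ⟨_, hd.hasDerivAt, ?_⟩
    have hpair : HasDerivAt (fun q => ((q, M.pStar Θ l u q) : ℝ × Price J))
        (1, deriv (M.pStar Θ l u) π) π := (hasDerivAt_id π).prodMk hd.hasDerivAt
    -- The equation for the derivative comes from differentiating the identity z_q(p*_q) = 0 at π.
    have h1 : HasDerivAt (fun q => M.z Θ q (M.pStar Θ l u q)) _ π :=
      HasFDerivAt.comp_hasDerivAt (l := fun x : ℝ × Price J => M.z Θ x.1 x.2) π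
        hjoint.hasFDerivAt hpair
    have h2 : (fun q => M.z Θ q (M.pStar Θ l u q)) =ᶠ[𝓝 π] fun _ => 0 := by
      filter_upwards [hgbox, heq] with q h1 h2
      rw [h2]
      exact h1.2
    have h3 := h1.unique ((hasDerivAt_const π (0 : Price J)).congr_of_eventuallyEq h2)
    simp only [add_apply, ContinuousLinearMap.comp_apply,
      ContinuousLinearMap.coe_snd', ContinuousLinearMap.smulRight_apply,
      ContinuousLinearMap.coe_fst', one_smul] at h3
    exact eq_neg_of_add_eq_zero_left h3

end Regular

end Market

/-! ### The law of the perturbations -/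

instance isProbabilityMeasure_perturbationLaw (h : ℝ) :
    IsProbabilityMeasure (perturbationLaw h) := by
  constructor
  simp [perturbationLaw, ENNReal.inv_two_add_inv_two]

lemma integral_perturbationLaw (h : ℝ) (f : ℝ → ℝ) :
    ∫ x, f x ∂(perturbationLaw h) = (f h + f (-h)) / 2 := by
  rw [perturbationLaw, integral_add_measure, integral_smul_measure, integral_smul_measure,
    integral_dirac, integral_dirac]
  · simp
    ring
  · exact (integrable_dirac (by simp)).smul_measure (by simp)
  · exact (integrable_dirac (by simp)).smul_measure (by simp)

lemma ae_perturbationLaw (h : ℝ) : ∀ᵐ x ∂(perturbationLaw h), x = h ∨ x = -h := by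
  rw [perturbationLaw, ae_add_measure_iff]
  constructor
  · refine Measure.ae_smul_measure ?_ _
    simp
  · refine Measure.ae_smul_measure ?_ _
    simp

lemma ae_pi_perturbationLaw (J : ℕ) (h : ℝ) :
    ∀ᵐ v ∂(Measure.pi fun _ : Fin J => perturbationLaw h), ∀ j, v j = h ∨ v j = -h :=
  ae_all_iff.2 fun j =>
    (Measure.quasiMeasurePreserving_eval (fun _ : Fin J => perturbationLaw h) j).ae
      (ae_perturbationLaw h)

lemma integral_pi_perturbationLaw_div {J : ℕ} (h : ℝ) (j : Fin J) :
    ∫ v, v j / h ∂(Measure.pi fun _ : Fin J => perturbationLaw h) = 0 := by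
  have h1 := integral_comp_eval (μ := fun _ : Fin J => perturbationLaw h) (i := j)
    (f := fun x : ℝ => x / h) (by fun_prop)
  rw [h1, integral_perturbationLaw]
  ring

lemma integral_pi_perturbationLaw_div_mul_div {J : ℕ} {h : ℝ} (hh : h ≠ 0) (j k : Fin J) :
    ∫ v, v j / h * (v k / h) ∂(Measure.pi fun _ : Fin J => perturbationLaw h) =
      if j = k then 1 else 0 := by
  split_ifs with hjk
  · subst hjk
    have h1 := integral_comp_eval (μ := fun _ : Fin J => perturbationLaw h) (i := j)
      (f := fun x : ℝ => x / h * (x / h)) (by fun_prop)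
    rw [h1, integral_perturbationLaw]
    field_simp
    ring
  -- Written as a product over all coordinates, the integrand factors under the product measure, and
  -- the factor at `j` has mean zero.
  · have h1 : (fun v : Fin J → ℝ => v j / h * (v k / h)) = fun v =>
        ∏ m, (if m = j ∨ m = k then v m / h else 1) := by
      ext v
      rw [Finset.prod_ite]
      have : Finset.univ.filter (fun m => m = j ∨ m = k) = {j, k} := by
        ext m; simp
      rw [this, Finset.prod_pair hjk]
      simp
    rw [h1, integral_fintype_prod_eq_prod (μ := fun _ : Fin J => perturbationLaw h)
      (f := fun m x => if m = j ∨ m = k then x / h else 1)]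
    refine Finset.prod_eq_zero (Finset.mem_univ j) ?_
    simp only [true_or, if_true]
    rw [integral_perturbationLaw]
    ring

/-! ### Laws of large numbers in the augmented experiment -/

namespace IsAugmentedExperiment

variable {J : ℕ} {G Ω : Type*} [MeasurableSpace G] [MeasurableSpace Ω] {μ : Measure Ω}
  {Θ : Measure G} [IsProbabilityMeasure Θ] {π : ℝ} {h : ℕ → ℝ} {A : (n : ℕ) → Ω → Fin n → G}
  {W : (n : ℕ) → Ω → Fin n → Bool} {U : (n : ℕ) → Ω → Matrix (Fin n) (Fin J) ℝ}

lemma eventually_perturbation [IsProbabilityMeasure (treatmentLaw π)]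
    (hexp : IsAugmentedExperiment μ Θ π h A W U) :
    ∀ᶠ x in whp μ, ∀ i j, U x.1 x.2 i j = h x.1 ∨ U x.1 x.2 i j = -h x.1 := by
  refine eventually_whp_of_ae (p := fun n ω => ∀ i j, U n ω i j = h n ∨ U n ω i j = -h n)
    (.of_forall fun n => ?_)
  have h1 : ∀ᵐ ξ ∂(Θ.prod ((treatmentLaw π).prod
      (Measure.pi fun _ : Fin J => perturbationLaw (h n)))), ∀ j, ξ.2.2 j = h n ∨ ξ.2.2 j = -h n :=
    (Measure.quasiMeasurePreserving_snd.comp Measure.quasiMeasurePreserving_snd).ae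
      (ae_pi_perturbationLaw J (h n))
  have h2 : ∀ᵐ ξ ∂(Measure.pi fun _ : Fin n => Θ.prod ((treatmentLaw π).prod
      (Measure.pi fun _ : Fin J => perturbationLaw (h n)))),
      ∀ i, ∀ j, (ξ i).2.2 j = h n ∨ (ξ i).2.2 j = -h n :=
    ae_all_iff.2 fun i => (Measure.quasiMeasurePreserving_eval (fun _ : Fin n =>
      Θ.prod ((treatmentLaw π).prod (Measure.pi fun _ : Fin J => perturbationLaw (h n)))) i).ae h1
  rw [← (hexp n).map_eq] at h2
  exact ae_of_ae_map (hexp n).aemeasurable h2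

/-- Perturbations are independent of agents and treatments, so the mean of the product factors. The
cases used are `χ` equal to 1, to one normalized perturbation, and to a product of two. The
conditions hold only eventually, since `h n` may fail to be positive for small n. -/
lemma tendsto_sum_mul [IsProbabilityMeasure (treatmentLaw π)]
    (hexp : IsAugmentedExperiment μ Θ π h A W U) {a : G × Bool → ℝ} (ha : Measurable a) {C : ℝ}
    (hC : ∀ x, |a x| ≤ C) {χ : ℕ → (Fin J → ℝ) → ℝ} (hχ : ∀ n, Measurable (χ n))
    (hχ1 : ∀ᶠ n in atTop,
      ∀ᵐ v ∂(Measure.pi fun _ : Fin J => perturbationLaw (h n)), |χ n v| ≤ 1)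
    {m : ℝ} (hm : ∀ᶠ n in atTop,
      ∫ v, χ n v ∂(Measure.pi fun _ : Fin J => perturbationLaw (h n)) = m)
    {r : ℕ → ℝ} (hr : Tendsto (fun n : ℕ => n * r n ^ 2) atTop (𝓝 0)) :
    Tendsto (fun x : ℕ × Ω => r x.1 *
      (∑ i, a (A x.1 x.2 i, W x.1 x.2 i) * χ x.1 (U x.1 x.2 i) -
        x.1 * ((∫ y, a y ∂(Θ.prod (treatmentLaw π))) * m))) (whp μ) (𝓝 0) := by
  have hb : ∀ᶠ n in atTop, ∀ᵐ ξ ∂(Θ.prod ((treatmentLaw π).prod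
      (Measure.pi fun _ : Fin J => perturbationLaw (h n)))),
      |a (ξ.1, ξ.2.1) * χ n ξ.2.2| ≤ C := by
    filter_upwards [hχ1] with n hn
    filter_upwards [(Measure.quasiMeasurePreserving_snd.comp
      Measure.quasiMeasurePreserving_snd).ae hn] with ξ hξ
    rw [abs_mul]
    exact (mul_le_of_le_one_right (abs_nonneg _) hξ).trans (hC _)
  have hlim := tendsto_whp_mul_sum_sub hexp (φ := fun n ξ => a (ξ.1, ξ.2.1) * χ n ξ.2.2)
    (fun n => by have := hχ n; fun_prop) hb hr
  refine hlim.congr' ?_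
  filter_upwards [tendsto_fst_whp.eventually hm] with x hx
  congr 3
  rw [← hx, ← integral_prod_mul]
  have hmp := measurePreserving_prodAssoc Θ (treatmentLaw π)
    (Measure.pi fun _ : Fin J => perturbationLaw (h x.1))
  rw [← hmp.map_eq]
  rw [MeasureTheory.integral_map_equiv]
  rfl

variable [IsProbabilityMeasure (treatmentLaw π)]

lemma tendsto_average (hexp : IsAugmentedExperiment μ Θ π h A W U) {a : G × Bool → ℝ}
    (ha : Measurable a) {C : ℝ} (hC : ∀ x, |a x| ≤ C) :
    Tendsto (fun x : ℕ × Ω => (x.1 : ℝ)⁻¹ * ∑ i, a (A x.1 x.2 i, W x.1 x.2 i)) (whp μ)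
      (𝓝 (∫ y, a y ∂(Θ.prod (treatmentLaw π)))) := by
  have hr : Tendsto (fun n : ℕ => (n : ℝ) * (n : ℝ)⁻¹ ^ 2) atTop (𝓝 0) := by
    refine tendsto_inv_atTop_nhds_zero_nat.congr' ?_
    filter_upwards [eventually_gt_atTop 0] with n hn
    field_simp
  have := hexp.tendsto_sum_mul ha hC (χ := fun _ _ => 1) (fun _ => measurable_const) (by simp)
    (m := 1) (by simp) hr
  have h2 := this.add_const (∫ y, a y ∂(Θ.prod (treatmentLaw π)))
  rw [zero_add] at h2
  refine h2.congr' ?_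
  filter_upwards [tendsto_fst_whp.eventually (eventually_gt_atTop 0)] with x hx
  have hx' : (x.1 : ℝ) ≠ 0 := by positivity
  field_simp
  simp

lemma tendsto_scaled_average_of_integral_eq_zero
    (hexp : IsAugmentedExperiment μ Θ π h A W U)
    (hnh : Tendsto (fun n : ℕ => n * h n ^ 2) atTop atTop) {a : G × Bool → ℝ}
    (ha : Measurable a) {C : ℝ} (hC : ∀ x, |a x| ≤ C)
    (h0 : ∫ y, a y ∂(Θ.prod (treatmentLaw π)) = 0) :
    Tendsto (fun x : ℕ × Ω => (x.1 * h x.1)⁻¹ * ∑ i, a (A x.1 x.2 i, W x.1 x.2 i)) (whp μ)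
      (𝓝 0) := by
  have hr : Tendsto (fun n : ℕ => (n : ℝ) * (n * h n)⁻¹ ^ 2) atTop (𝓝 0) := by
    refine hnh.inv_tendsto_atTop.congr' ?_
    filter_upwards [eventually_gt_atTop 0] with n hn
    simp only [Pi.inv_apply]
    field_simp
  have := hexp.tendsto_sum_mul ha hC (χ := fun _ _ => 1) (fun _ => measurable_const) (by simp)
    (m := 1) (by simp) hr
  simpa [h0] using this

/-- The normalized perturbation is a centred sign, and the rate 1/(n h) is admissible because n · (n
h)⁻² = (n h²)⁻¹ → 0. -/
lemma tendsto_scaled_average_mul (hexp : IsAugmentedExperiment μ Θ π h A W U)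
    (hpos : ∀ᶠ n in atTop, 0 < h n)
    (hnh : Tendsto (fun n : ℕ => n * h n ^ 2) atTop atTop) {a : G × Bool → ℝ}
    (ha : Measurable a) {C : ℝ} (hC : ∀ x, |a x| ≤ C) (j : Fin J) :
    Tendsto (fun x : ℕ × Ω => (x.1 * h x.1)⁻¹ *
      ∑ i, a (A x.1 x.2 i, W x.1 x.2 i) * (U x.1 x.2 i j / h x.1)) (whp μ) (𝓝 0) := by
  have hr : Tendsto (fun n : ℕ => (n : ℝ) * (n * h n)⁻¹ ^ 2) atTop (𝓝 0) := by
    refine hnh.inv_tendsto_atTop.congr' ?_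
    filter_upwards [eventually_gt_atTop 0] with n hn
    simp only [Pi.inv_apply]
    field_simp
  have := hexp.tendsto_sum_mul ha hC (χ := fun n v => v j / h n) (fun n => by fun_prop)
    (by
      filter_upwards [hpos] with n hn
      filter_upwards [ae_pi_perturbationLaw J (h n)] with v hv
      rcases hv j with h1 | h1 <;> simp [h1, hn.ne'])
    (m := 0) (.of_forall fun n => integral_pi_perturbationLaw_div (h n) j) hr
  simpa using this

lemma tendsto_average_mul_mul (hexp : IsAugmentedExperiment μ Θ π h A W U)
    (hpos : ∀ᶠ n in atTop, 0 < h n) {a : G × Bool → ℝ}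
    (ha : Measurable a) {C : ℝ} (hC : ∀ x, |a x| ≤ C) (j k : Fin J) :
    Tendsto (fun x : ℕ × Ω => (x.1 : ℝ)⁻¹ *
      ∑ i, a (A x.1 x.2 i, W x.1 x.2 i) * (U x.1 x.2 i j / h x.1 * (U x.1 x.2 i k / h x.1)))
      (whp μ) (𝓝 (if j = k then ∫ y, a y ∂(Θ.prod (treatmentLaw π)) else 0)) := by
  have hr : Tendsto (fun n : ℕ => (n : ℝ) * (n : ℝ)⁻¹ ^ 2) atTop (𝓝 0) := by
    refine tendsto_inv_atTop_nhds_zero_nat.congr' ?_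
    filter_upwards [eventually_gt_atTop 0] with n hn
    field_simp
  have := hexp.tendsto_sum_mul ha hC (χ := fun n v => v j / h n * (v k / h n))
    (fun n => by fun_prop)
    (by
      filter_upwards [hpos] with n hn
      filter_upwards [ae_pi_perturbationLaw J (h n)] with v hv
      rcases hv j with h1 | h1 <;> rcases hv k with h2 | h2 <;> simp [h1, h2, hn.ne'])
    (m := if j = k then 1 else 0)
    (by
      filter_upwards [hpos] with n hn
      exact integral_pi_perturbationLaw_div_mul_div hn.ne' j k) hr
  have h2 := this.add_const ((∫ y, a y ∂(Θ.prod (treatmentLaw π))) * if j = k then 1 else 0)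
  rw [zero_add, mul_ite, mul_one, mul_zero] at h2
  refine h2.congr' ?_
  filter_upwards [tendsto_fst_whp.eventually (eventually_gt_atTop 0)] with x hx
  have hx' : (x.1 : ℝ) ≠ 0 := by positivity
  rw [mul_sub, inv_mul_cancel_left₀ hx', sub_add_cancel]

lemma eventually_uniform_average (hexp : IsAugmentedExperiment μ Θ π h A W U)
    {F : G × Bool → Price J → ℝ} {V T : Set (Price J)} {C : ℝ} (hF : SmoothFamily F V C)
    (hV : Convex ℝ V) (hVo : IsOpen V) (hT : IsCompact T) (hTV : T ⊆ V) {ε : ℝ} (hε : 0 < ε) :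
    ∀ᶠ x in whp μ, ∀ p ∈ T, |(x.1 : ℝ)⁻¹ * ∑ i, F (A x.1 x.2 i, W x.1 x.2 i) p -
      ∫ y, F y p ∂(Θ.prod (treatmentLaw π))| < ε := by
  obtain ⟨B, hB⟩ := hF.exists_measure_pi_le hV hVo (Θ.prod (treatmentLaw π)) hT hTV hε
  rw [eventually_whp_iff]
  have hlim : Tendsto (fun n : ℕ => ENNReal.ofReal (B / n)) atTop (𝓝 0) := by
    have := ENNReal.tendsto_ofReal (tendsto_const_div_atTop_nhds_zero_nat B)
    simpa using this
  refine tendsto_of_tendsto_of_tendsto_of_le_of_le' tendsto_const_nhds hlim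
    (.of_forall fun _ => zero_le) ?_
  filter_upwards [eventually_gt_atTop 0] with n hn
  have hlaw : HasLaw (fun ω => (fun i => (A n ω i, W n ω i) : Fin n → G × Bool))
      (Measure.pi fun _ : Fin n => Θ.prod (treatmentLaw π)) μ := by
    have hmp : MeasurePreserving (fun ξ : G × Bool × (Fin J → ℝ) => (ξ.1, ξ.2.1))
        (Θ.prod ((treatmentLaw π).prod (Measure.pi fun _ : Fin J => perturbationLaw (h n))))
        (Θ.prod (treatmentLaw π)) :=
      (MeasurePreserving.id Θ).prod measurePreserving_fst
    have hmp' := measurePreserving_pi (fun _ : Fin n => Θ.prod ((treatmentLaw π).prod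
      (Measure.pi fun _ : Fin J => perturbationLaw (h n))))
      (fun _ : Fin n => Θ.prod (treatmentLaw π)) (fun _ => hmp)
    refine ⟨hmp'.measurable.comp_aemeasurable (hexp n).aemeasurable, ?_⟩
    have := AEMeasurable.map_map_of_aemeasurable (hmp'.measurable.aemeasurable)
      (hexp n).aemeasurable
    rw [(hexp n).map_eq, hmp'.map_eq] at this
    exact this.symm
  have hle := hB n hn
  rw [← hlaw.map_eq] at hle
  -- The uniform deviation event need not be measurable; only an inequality for the outer measure of
  -- a preimage is required.
  refine (measure_mono ?_).trans ((Measure.le_map_apply hlaw.aemeasurable _).trans hle)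
  intro ω hω
  simp only [Set.mem_ofPred_eq, not_forall, not_lt, exists_prop] at hω
  exact hω

end IsAugmentedExperiment

/-! ### Averages and regressions at the market price -/

lemma norm_facedPrice_sub_le {J n : ℕ} {U : Matrix (Fin n) (Fin J) ℝ} {h : ℝ} (hh : 0 ≤ h)
    {i : Fin n} (hU : ∀ j, U i j = h ∨ U i j = -h) (p q : Price J) :
    ‖Market.facedPrice U p i - q‖ ≤ ‖p - q‖ + J * h := by
  have h1 : Market.facedPrice U p i - q = (p - q) + WithLp.toLp 2 (U i) := by
    rw [Market.facedPrice]
    abel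
  rw [h1]
  refine (norm_add_le _ _).trans (add_le_add_right (norm_le_card_mul fun j => ?_) _)
  rcases hU j with h2 | h2 <;> simp [h2, abs_of_nonneg hh]

namespace IsAugmentedExperiment

variable {J : ℕ} {G Ω : Type*} [MeasurableSpace G] [MeasurableSpace Ω] {μ : Measure Ω}
  {Θ : Measure G} [IsProbabilityMeasure Θ] {π : ℝ} [IsProbabilityMeasure (treatmentLaw π)]
  {h : ℕ → ℝ} {A : (n : ℕ) → Ω → Fin n → G}
  {W : (n : ℕ) → Ω → Fin n → Bool} {U : (n : ℕ) → Ω → Matrix (Fin n) (Fin J) ℝ}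
  {F : G × Bool → Price J → ℝ} {V : Set (Price J)} {C K : ℝ} {p₀ : Price J}
  {P : ℕ → Ω → Price J}

lemma abs_average_sub_le (hF : SmoothFamily F V C) (hV : Convex ℝ V) {n : ℕ}
    (a : Fin n → G × Bool) {p q : Fin n → Price J} (hp : ∀ i, p i ∈ V) (hq : ∀ i, q i ∈ V)
    {δ : ℝ} (hC : 0 ≤ C) (hδ : 0 ≤ δ) (hpq : ∀ i, ‖p i - q i‖ ≤ δ) :
    |(n : ℝ)⁻¹ * ∑ i, F (a i) (p i) - (n : ℝ)⁻¹ * ∑ i, F (a i) (q i)| ≤ C * δ := by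
  rw [← mul_sub, ← Finset.sum_sub_distrib, abs_mul, abs_of_nonneg (by positivity)]
  have h1 : |∑ i, (F (a i) (p i) - F (a i) (q i))| ≤ n * (C * δ) := by
    refine (Finset.abs_sum_le_sum_abs _ _).trans ((Finset.sum_le_card_nsmul _ _ (C * δ)
      fun i _ => ?_).trans_eq (by simp))
    exact (hF.abs_sub_le hV (a i) (hq i) (hp i)).trans (by gcongr; exact hpq i)
  rcases Nat.eq_zero_or_pos n with rfl | hn
  · simp only [CharP.cast_eq_zero, inv_zero, zero_mul]
    positivity
  · rw [inv_mul_le_iff₀ (by positivity)]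
    exact h1

lemma eventually_norm_facedPrice_sub_le (hexp : IsAugmentedExperiment μ Θ π h A W U)
    (hpos : ∀ᶠ n in atTop, 0 < h n)
    (hPK : ∀ᶠ x in whp μ, ‖P x.1 x.2 - p₀‖ ≤ K * h x.1) :
    ∀ᶠ x in whp μ, ∀ i, ‖Market.facedPrice (U x.1 x.2) (P x.1 x.2) i - p₀‖ ≤ (K + J) * h x.1 := by
  filter_upwards [hexp.eventually_perturbation, tendsto_fst_whp.eventually hpos, hPK]
    with x hU hx hK i
  refine (norm_facedPrice_sub_le hx.le (hU i) _ _).trans ?_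
  linarith

/-- The price depends on the whole sample, so the summands are not independent. The uniform
Lipschitz bound replaces every faced price by `p₀` at cost O(h). -/
lemma tendsto_average_facedPrice (hexp : IsAugmentedExperiment μ Θ π h A W U)
    (hpos : ∀ᶠ n in atTop, 0 < h n) (hh : Tendsto h atTop (𝓝 0))
    (hF : SmoothFamily F V C) (hV : Convex ℝ V) (hp₀ : p₀ ∈ V)
    (hPV : ∀ᶠ x in whp μ, ∀ i, Market.facedPrice (U x.1 x.2) (P x.1 x.2) i ∈ V)
    (hPK : ∀ᶠ x in whp μ, ‖P x.1 x.2 - p₀‖ ≤ K * h x.1) :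
    Tendsto (fun x : ℕ × Ω => (x.1 : ℝ)⁻¹ * ∑ i, F (A x.1 x.2 i, W x.1 x.2 i)
        (Market.facedPrice (U x.1 x.2) (P x.1 x.2) i)) (whp μ)
      (𝓝 (∫ y, F y p₀ ∂(Θ.prod (treatmentLaw π)))) := by
  have := (Θ.prod (treatmentLaw π)).nonempty_of_neZero
  have hC := hF.nonneg hp₀
  have h1 := hexp.tendsto_average (hF.measurable p₀) (fun y => hF.bound y p₀ hp₀)
  have hlim : Tendsto (fun x : ℕ × Ω => C * ((K + J) * h x.1)) (whp μ) (𝓝 0) := by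
    have := ((hh.comp (tendsto_fst_whp (μ := μ))).const_mul (K + J)).const_mul C
    simpa using this
  have h2 : Tendsto (fun x : ℕ × Ω => (x.1 : ℝ)⁻¹ * ∑ i, F (A x.1 x.2 i, W x.1 x.2 i)
        (Market.facedPrice (U x.1 x.2) (P x.1 x.2) i) -
        (x.1 : ℝ)⁻¹ * ∑ i, F (A x.1 x.2 i, W x.1 x.2 i) p₀) (whp μ) (𝓝 0) := by
    refine squeeze_zero_norm' ?_ hlim
    filter_upwards [hPV, hexp.eventually_norm_facedPrice_sub_le hpos hPK, hPK,
      tendsto_fst_whp.eventually hpos] with x hx1 hx2 hx3 hx4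
    have hK : 0 ≤ K := nonneg_of_mul_nonneg_left ((norm_nonneg _).trans hx3) hx4
    exact abs_average_sub_le hF hV (fun i => (A x.1 x.2 i, W x.1 x.2 i)) (q := fun _ => p₀) hx1
      (fun _ => hp₀) hC (by positivity) hx2
  simpa using h2.add h1

/-- Expanding at the deterministic `p₀`, not at the market price, keeps the sums i.i.d.; the random
factor `P - p₀` comes out of them. The rate O(h) for `P - p₀` makes the quadratic remainder
negligible after division by h. -/
lemma tendsto_regression (hexp : IsAugmentedExperiment μ Θ π h A W U)
    (hpos : ∀ᶠ n in atTop, 0 < h n) (hh : Tendsto h atTop (𝓝 0))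
    (hnh : Tendsto (fun n : ℕ => n * h n ^ 2) atTop atTop)
    (hF : SmoothFamily F V C) (hV : Convex ℝ V) (hVo : IsOpen V) (hp₀ : p₀ ∈ V)
    (hPV : ∀ᶠ x in whp μ, ∀ i, Market.facedPrice (U x.1 x.2) (P x.1 x.2) i ∈ V)
    (hPK : ∀ᶠ x in whp μ, ‖P x.1 x.2 - p₀‖ ≤ K * h x.1) (j : Fin J) :
    Tendsto (fun x : ℕ × Ω => (x.1 * h x.1 ^ 2)⁻¹ * ∑ i, U x.1 x.2 i j *
        F (A x.1 x.2 i, W x.1 x.2 i) (Market.facedPrice (U x.1 x.2) (P x.1 x.2) i)) (whp μ)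
      (𝓝 (fderiv ℝ (fun p => ∫ y, F y p ∂(Θ.prod (treatmentLaw π))) p₀
        (EuclideanSpace.single j 1))) := by
  have := (Θ.prod (treatmentLaw π)).nonempty_of_neZero
  have hC := hF.nonneg hp₀
  set D : Fin J → G × Bool → ℝ := fun k y => fderiv ℝ (F y) p₀ (EuclideanSpace.single k 1) with hD
  have hDm : ∀ k, Measurable (D k) := fun k => hF.measurable_fderiv_apply hp₀ _
  have hDC : ∀ k y, |D k y| ≤ C := fun k y => by
    have h1 := (fderiv ℝ (F y) p₀).le_opNorm (EuclideanSpace.single k 1)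
    simp only [PiLp.norm_single, norm_one, mul_one] at h1
    exact h1.trans (hF.bound_fderiv y p₀ hp₀)
  have ht1 := hexp.tendsto_scaled_average_mul hpos hnh (hF.measurable p₀)
    (fun y => hF.bound y p₀ hp₀) j
  have hhx : Tendsto (fun x : ℕ × Ω => h x.1) (whp μ) (𝓝 0) := hh.comp tendsto_fst_whp
  have hPlim : ∀ k, Tendsto (fun x : ℕ × Ω => (P x.1 x.2 - p₀) k) (whp μ) (𝓝 0) := by
    intro k
    refine squeeze_zero_norm' (a := fun x : ℕ × Ω => K * h x.1) ?_ (by simpa using hhx.const_mul K)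
    filter_upwards [hPK] with x hx using (abs_apply_le_norm _ k).trans hx
  have ht2 := tendsto_finsetSum Finset.univ fun k (_ : k ∈ Finset.univ) =>
    (hPlim k).mul (hexp.tendsto_scaled_average_mul hpos hnh (hDm k) (hDC k) j)
  have ht3 := tendsto_finsetSum Finset.univ fun k (_ : k ∈ Finset.univ) =>
    hexp.tendsto_average_mul_mul hpos (hDm k) (hDC k) j k
  have ht := (ht1.add ht2).add ht3
  simp only [mul_zero, Finset.sum_const_zero, add_zero, zero_add, Finset.sum_ite_eq,
    Finset.mem_univ, if_true] at ht
  rw [hF.fderiv_integral_apply _ hVo hp₀]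
  have hlim : Tendsto (fun x : ℕ × Ω => C * (K + J) ^ 2 * h x.1) (whp μ) (𝓝 0) := by
    simpa using hhx.const_mul (C * (K + J) ^ 2)
  refine tendsto_of_tendsto_of_dist ht ?_
  refine squeeze_zero' (.of_forall fun _ => dist_nonneg) ?_ hlim
  filter_upwards [hPV, hexp.eventually_norm_facedPrice_sub_le hpos hPK, hPK,
      tendsto_fst_whp.eventually hpos, tendsto_fst_whp.eventually (eventually_gt_atTop 0),
      hexp.eventually_perturbation] with x hx1 hx2 hx3 hx4 hx5 hx6
  rw [dist_comm, Real.dist_eq]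
  have hn : (0 : ℝ) < x.1 := by exact_mod_cast hx5
  have hn0 := hn.ne'
  have hh0 := hx4.ne'
  set q := fun i => Market.facedPrice (U x.1 x.2) (P x.1 x.2) i with hq
  set R := fun i => F (A x.1 x.2 i, W x.1 x.2 i) (q i) - F (A x.1 x.2 i, W x.1 x.2 i) p₀ -
    fderiv ℝ (F (A x.1 x.2 i, W x.1 x.2 i)) p₀ (q i - p₀) with hR
  have hRb : ∀ i, |R i| ≤ C * ((K + J) * h x.1) ^ 2 := fun i =>
    (hF.taylor hV _ hp₀ (hx1 i)).trans (by gcongr; exact hx2 i)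
  have hRe : ∀ i, F (A x.1 x.2 i, W x.1 x.2 i) (q i) = F (A x.1 x.2 i, W x.1 x.2 i) p₀ +
      ∑ k, (P x.1 x.2 - p₀) k * D k (A x.1 x.2 i, W x.1 x.2 i) +
      ∑ k, U x.1 x.2 i k * D k (A x.1 x.2 i, W x.1 x.2 i) + R i := by
    intro i
    rw [hR]
    simp only
    rw [clm_apply_eq_sum _ (q i - p₀), add_assoc (F _ p₀), ← Finset.sum_add_distrib]
    have : ∀ k, (q i - p₀) k * fderiv ℝ (F (A x.1 x.2 i, W x.1 x.2 i)) p₀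
        (EuclideanSpace.single k 1) = (P x.1 x.2 - p₀) k * D k (A x.1 x.2 i, W x.1 x.2 i) +
        U x.1 x.2 i k * D k (A x.1 x.2 i, W x.1 x.2 i) := by
      intro k
      rw [← add_mul, hq]
      simp only [Market.facedPrice, PiLp.sub_apply, PiLp.add_apply]
      congr 1
      ring
    simp_rw [this]
    ring
  -- Apart from the Taylor remainders, the sum is exactly the three terms whose limits are in `ht`:
  -- constant, `P - p₀`, and perturbation.
  have hdiff : (x.1 * h x.1 ^ 2)⁻¹ * ∑ i, U x.1 x.2 i j * F (A x.1 x.2 i, W x.1 x.2 i) (q i) -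
      (((x.1 * h x.1)⁻¹ * ∑ i, F (A x.1 x.2 i, W x.1 x.2 i) p₀ * (U x.1 x.2 i j / h x.1) +
        ∑ k, (P x.1 x.2 - p₀) k * ((x.1 * h x.1)⁻¹ * ∑ i, D k (A x.1 x.2 i, W x.1 x.2 i) *
          (U x.1 x.2 i j / h x.1))) +
        ∑ k, (x.1 : ℝ)⁻¹ * ∑ i, D k (A x.1 x.2 i, W x.1 x.2 i) *
          (U x.1 x.2 i j / h x.1 * (U x.1 x.2 i k / h x.1))) =
      ∑ i, (x.1 * h x.1)⁻¹ * (U x.1 x.2 i j / h x.1) * R i := by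
    have e2 : ∑ k, (P x.1 x.2 - p₀) k * ((x.1 * h x.1)⁻¹ *
        ∑ i, D k (A x.1 x.2 i, W x.1 x.2 i) * (U x.1 x.2 i j / h x.1)) =
        ∑ i, (x.1 * h x.1)⁻¹ * (U x.1 x.2 i j / h x.1) *
          ∑ k, (P x.1 x.2 - p₀) k * D k (A x.1 x.2 i, W x.1 x.2 i) := by
      simp only [Finset.mul_sum]
      rw [Finset.sum_comm]
      exact Finset.sum_congr rfl fun i _ => Finset.sum_congr rfl fun k _ => by ring
    have e3 : ∑ k, (x.1 : ℝ)⁻¹ * ∑ i, D k (A x.1 x.2 i, W x.1 x.2 i) *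
          (U x.1 x.2 i j / h x.1 * (U x.1 x.2 i k / h x.1)) =
        ∑ i, (x.1 * h x.1)⁻¹ * (U x.1 x.2 i j / h x.1) *
          ∑ k, U x.1 x.2 i k * D k (A x.1 x.2 i, W x.1 x.2 i) := by
      simp only [Finset.mul_sum]
      rw [Finset.sum_comm]
      exact Finset.sum_congr rfl fun i _ => Finset.sum_congr rfl fun k _ => by field_simp
    rw [e2, e3, Finset.mul_sum, Finset.mul_sum, ← Finset.sum_add_distrib, ← Finset.sum_add_distrib,
      ← Finset.sum_sub_distrib]
    refine Finset.sum_congr rfl fun i _ => ?_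
    rw [hRe i]
    field_simp
    ring
  rw [hdiff]
  refine (Finset.abs_sum_le_sum_abs _ _).trans ?_
  -- The normalized perturbation has modulus one, so n summands of size (n h)⁻¹ · C((K + J)h)² add
  -- up to C(K + J)² h.
  refine (Finset.sum_le_card_nsmul _ _ ((x.1 * h x.1)⁻¹ * (C * ((K + J) * h x.1) ^ 2))
    fun i _ => ?_).trans_eq ?_
  · rw [abs_mul, abs_mul, abs_of_pos (by positivity : 0 < (x.1 * h x.1)⁻¹)]
    have hU1 : |U x.1 x.2 i j / h x.1| = 1 := by
      rcases hx6 i j with h1 | h1 <;> simp [h1, hh0]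
    rw [hU1, mul_one]
    gcongr
    exact hRb i
  · simp only [Finset.card_univ, Fintype.card_fin, nsmul_eq_mul]
    field_simp

end IsAugmentedExperiment

/-! ### Rate of convergence of the market price -/

namespace SmoothFamily

variable {J : ℕ} {X : Type*} [MeasurableSpace X] {F : X → Price J → ℝ} {V : Set (Price J)} {C : ℝ}

/-- The increments of sample averages are close to those of the mean. -/
lemma abs_increment_sub_increment_le (hF : SmoothFamily F V C) (hV : Convex ℝ V) (hVo : IsOpen V)
    (ν : Measure X) [IsProbabilityMeasure ν] {p₀ p : Price J} (hp₀ : p₀ ∈ V) (hp : p ∈ V)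
    {n : ℕ} (hn : 0 < n) (a : Fin n → X) {η : ℝ}
    (hη : ∀ m : Fin J, |(n : ℝ)⁻¹ * ∑ i, fderiv ℝ (F (a i)) p₀ (EuclideanSpace.single m 1) -
      ∫ y, fderiv ℝ (F y) p₀ (EuclideanSpace.single m 1) ∂ν| ≤ η) :
    |(∫ y, F y p ∂ν - ∫ y, F y p₀ ∂ν) -
      ((n : ℝ)⁻¹ * ∑ i, F (a i) p - (n : ℝ)⁻¹ * ∑ i, F (a i) p₀)| ≤
      (2 * C * ‖p - p₀‖ + J * η) * ‖p - p₀‖ := by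
  have := ν.nonempty_of_neZero
  have hn' : (0 : ℝ) < n := by exact_mod_cast hn
  set d := p - p₀ with hd
  -- The mean and the sample average each contribute a remainder C‖d‖², and their linear parts
  -- differ by at most η per coordinate of `d`.
  have h1 := (hF.integral ν hVo).taylor hV () hp₀ hp
  have h2 : |(n : ℝ)⁻¹ * ∑ i, F (a i) p - (n : ℝ)⁻¹ * ∑ i, F (a i) p₀ -
      (n : ℝ)⁻¹ * ∑ i, fderiv ℝ (F (a i)) p₀ d| ≤ C * ‖d‖ ^ 2 := by
    rw [← mul_sub, ← mul_sub, ← Finset.sum_sub_distrib, ← Finset.sum_sub_distrib, abs_mul,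
      abs_of_pos (inv_pos.2 hn'), inv_mul_le_iff₀ hn']
    refine (Finset.abs_sum_le_sum_abs _ _).trans ((Finset.sum_le_card_nsmul _ _ (C * ‖d‖ ^ 2)
      fun i _ => hF.taylor hV (a i) hp₀ hp).trans_eq (by simp))
  have h3 : fderiv ℝ (fun p => ∫ y, F y p ∂ν) p₀ d - (n : ℝ)⁻¹ * ∑ i, fderiv ℝ (F (a i)) p₀ d =
      -∑ m, d m * ((n : ℝ)⁻¹ * ∑ i, fderiv ℝ (F (a i)) p₀ (EuclideanSpace.single m 1) -
        ∫ y, fderiv ℝ (F y) p₀ (EuclideanSpace.single m 1) ∂ν) := by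
    rw [clm_apply_eq_sum]
    have : ∀ i, fderiv ℝ (F (a i)) p₀ d =
        ∑ m, d m * fderiv ℝ (F (a i)) p₀ (EuclideanSpace.single m 1) :=
      fun i => clm_apply_eq_sum _ d
    simp_rw [this, hF.fderiv_integral_apply ν hVo hp₀]
    rw [Finset.sum_comm, Finset.mul_sum, ← Finset.sum_sub_distrib, ← Finset.sum_neg_distrib]
    refine Finset.sum_congr rfl fun m _ => ?_
    rw [← Finset.mul_sum]
    ring
  have h4 : |fderiv ℝ (fun p => ∫ y, F y p ∂ν) p₀ d -
      (n : ℝ)⁻¹ * ∑ i, fderiv ℝ (F (a i)) p₀ d| ≤ J * η * ‖d‖ := by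
    rw [h3, abs_neg]
    refine (Finset.abs_sum_le_sum_abs _ _).trans ((Finset.sum_le_card_nsmul _ _ (‖d‖ * η)
      fun m _ => ?_).trans_eq ?_)
    · rw [abs_mul]
      exact mul_le_mul (abs_apply_le_norm d m) (hη m) (abs_nonneg _) (norm_nonneg _)
    · simp only [Finset.card_univ, Fintype.card_fin, nsmul_eq_mul]
      ring
  rw [abs_le] at h1 h2 h4 ⊢
  constructor <;> nlinarith

end SmoothFamily

namespace Market.Regular

variable {J : ℕ} {G Ω : Type*} [MeasurableSpace G] [MeasurableSpace Ω] {M : Market J G}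
  {μ : Measure Ω} {Θ : Measure G} [IsProbabilityMeasure Θ] {l u : Price J} {π : ℝ}
  {h : ℕ → ℝ} {A : (n : ℕ) → Ω → Fin n → G} {W : (n : ℕ) → Ω → Fin n → Bool}
  {U : (n : ℕ) → Ω → Matrix (Fin n) (Fin J) ℝ} {r C ρ : ℝ} {p₀ : Price J} {P : ℕ → Ω → Price J}

lemma eventually_facedPrice_mem [IsProbabilityMeasure (treatmentLaw π)] (hr : 0 < r)
    (hexp : IsAugmentedExperiment μ Θ π h A W U)
    (hpos : ∀ᶠ n in atTop, 0 < h n) (hh : Tendsto h atTop (𝓝 0)) :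
    ∀ᶠ x in whp μ, ∀ p ∈ priceBox l u, ∀ i,
      facedPrice (U x.1 x.2) p i ∈ Metric.thickening r (priceBox l u) := by
  have hlim : Tendsto (fun n => J * h n) atTop (𝓝 0) := by simpa using hh.const_mul (J : ℝ)
  filter_upwards [hexp.eventually_perturbation, tendsto_fst_whp.eventually hpos,
    tendsto_fst_whp.eventually (hlim.eventually_lt_const hr)] with x hU hx hJ p hp i
  refine Metric.mem_thickening_iff.2 ⟨p, hp, ?_⟩
  have := norm_facedPrice_sub_le hx.le (hU i) p p
  rw [sub_self, norm_zero, zero_add] at this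
  exact (dist_eq_norm _ p).trans_lt (this.trans_lt hJ)

/-- The unperturbed sample excess demand at the market price is of the order of the
perturbations. -/
lemma eventually_abs_average_excess_le [IsProbabilityMeasure (treatmentLaw π)] (hr : 0 < r)
    (hreg : M.Regular Θ l u π (Metric.thickening r (priceBox l u)) C ρ) (h0 : 0 ≤ π) (h1 : π ≤ 1)
    (hexp : IsAugmentedExperiment μ Θ π h A W U)
    (hpos : ∀ᶠ n in atTop, 0 < h n) (hh : Tendsto h atTop (𝓝 0))
    (hnh : Tendsto (fun n : ℕ => n * h n ^ 2) atTop atTop)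
    (hp₀ : p₀ ∈ priceBox l u) (hz : M.z Θ π p₀ = 0)
    (hP : ∀ᶠ x in whp μ, M.IsMarketPrice l u (A x.1 x.2) (W x.1 x.2) (U x.1 x.2) (P x.1 x.2)) :
    ∃ K, 0 ≤ K ∧ ∀ᶠ x in whp μ, ∀ k,
      |(x.1 : ℝ)⁻¹ * ∑ i, M.excess k (A x.1 x.2 i, W x.1 x.2 i) p₀| ≤ K * h x.1 ∧
      |(x.1 : ℝ)⁻¹ * ∑ i, M.excess k (A x.1 x.2 i, W x.1 x.2 i) (P x.1 x.2)| ≤ K * h x.1 := by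
  have := (Θ.prod (treatmentLaw π)).nonempty_of_neZero
  have hsub : priceBox l u ⊆ Metric.thickening r (priceBox l u) :=
    Metric.self_subset_thickening hr _
  by_cases hJ : J = 0
  · subst hJ
    exact ⟨0, le_rfl, .of_forall fun x k => k.elim0⟩
  have hC : 0 ≤ C := (hreg.smooth_excess ⟨0, Nat.pos_of_ne_zero hJ⟩).nonneg (hsub hp₀)
  have hmean : ∀ k, ∫ y, M.excess k y p₀ ∂(Θ.prod (treatmentLaw π)) = 0 := fun k => by
    rw [← hreg.z_apply h0 h1 (hsub hp₀), hz]
    rfl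
  have hsmall : ∀ᶠ x in whp μ, ∀ k,
      |(x.1 : ℝ)⁻¹ * ∑ i, M.excess k (A x.1 x.2 i, W x.1 x.2 i) p₀| ≤ h x.1 := by
    rw [eventually_all]
    intro k
    have hlim := hexp.tendsto_scaled_average_of_integral_eq_zero hnh
      ((hreg.smooth_excess k).measurable p₀)
      (fun y => (hreg.smooth_excess k).bound y p₀ (hsub hp₀)) (hmean k)
    have := hlim.abs
    rw [abs_zero] at this
    filter_upwards [this.eventually_lt_const one_pos, tendsto_fst_whp.eventually hpos] with x hx hx'
    rw [mul_inv, mul_comm (x.1 : ℝ)⁻¹, mul_assoc, abs_mul, abs_of_pos (inv_pos.2 hx'),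
      inv_mul_lt_iff₀ hx', mul_one] at hx
    exact hx.le
  -- At `p₀` the perturbed excess has norm at most J(1 + CJ)h, and minimality passes this bound to
  -- the market price. Removing the perturbations there adds CJh, and the `+ 1` covers the
  -- unperturbed average at `p₀`.
  refine ⟨J * (1 + C * J) + C * J + 1, by positivity, ?_⟩
  filter_upwards [hsmall, hP, eventually_facedPrice_mem hr hexp hpos hh,
    tendsto_fst_whp.eventually hpos, hexp.eventually_perturbation] with x hx hPx hfx hhx hUx k
  have hclose : ∀ p ∈ priceBox l u, ∀ k, |M.avgExcess (A x.1 x.2) (W x.1 x.2) (U x.1 x.2) p k -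
      (x.1 : ℝ)⁻¹ * ∑ i, M.excess k (A x.1 x.2 i, W x.1 x.2 i) p| ≤ C * (J * h x.1) := by
    intro p hp k
    have h2 := IsAugmentedExperiment.abs_average_sub_le (hreg.smooth_excess k) hreg.convex
      (fun i => (A x.1 x.2 i, W x.1 x.2 i)) (p := fun i => facedPrice (U x.1 x.2) p i)
      (q := fun _ => p) (hfx p hp) (fun _ => hsub hp) hC (δ := J * h x.1) (by positivity)
      (fun i => by simpa using norm_facedPrice_sub_le hhx.le (hUx i) p p)
    simpa [avgExcess, excess] using h2
  have hU0 : ‖M.avgExcess (A x.1 x.2) (W x.1 x.2) (U x.1 x.2) p₀‖ ≤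
      J * (h x.1 + C * (J * h x.1)) := by
    refine norm_le_card_mul fun k => ?_
    have h2 := hclose p₀ hp₀ k
    have h3 := hx k
    rw [abs_le] at h2 h3 ⊢
    constructor <;> linarith
  have hUP := (abs_apply_le_norm _ k).trans ((hPx.2 p₀ hp₀).trans hU0)
  have h4 := hclose _ hPx.1 k
  have hJJ : 0 ≤ (J : ℝ) * (1 + C * J) + C * J := by positivity
  constructor
  · refine (hx k).trans ?_
    nlinarith
  · rw [abs_le] at h4 hUP ⊢
    constructor <;> nlinarith

/-- The market price converges to the mean-field price at the rate of the perturbations. -/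
lemma exists_eventually_norm_sub_le [IsProbabilityMeasure (treatmentLaw π)] (hr : 0 < r)
    (hreg : M.Regular Θ l u π (Metric.thickening r (priceBox l u)) C ρ) (h0 : 0 ≤ π) (h1 : π ≤ 1)
    (hexp : IsAugmentedExperiment μ Θ π h A W U)
    (hpos : ∀ᶠ n in atTop, 0 < h n) (hh : Tendsto h atTop (𝓝 0))
    (hnh : Tendsto (fun n : ℕ => n * h n ^ 2) atTop atTop)
    (hp₀ : p₀ ∈ priceBox l u) (hz : M.z Θ π p₀ = 0)
    (hP : ∀ᶠ x in whp μ, M.IsMarketPrice l u (A x.1 x.2) (W x.1 x.2) (U x.1 x.2) (P x.1 x.2)) :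
    ∃ K, ∀ᶠ x in whp μ, ‖P x.1 x.2 - p₀‖ ≤ K * h x.1 := by
  have := (Θ.prod (treatmentLaw π)).nonempty_of_neZero
  have hsub : priceBox l u ⊆ Metric.thickening r (priceBox l u) :=
    Metric.self_subset_thickening hr _
  obtain ⟨K₁, hK₁, hex⟩ := hreg.eventually_abs_average_excess_le hr h0 h1 hexp hpos hh hnh hp₀ hz hP
  by_cases hJ : J = 0
  · subst hJ
    exact ⟨0, .of_forall fun x => by simp [Subsingleton.elim (P x.1 x.2) p₀]⟩
  have hC : 0 ≤ C := (hreg.smooth_excess ⟨0, Nat.pos_of_ne_zero hJ⟩).nonneg (hsub hp₀)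
  have hγ : 0 < 1 - ρ := sub_pos.2 hreg.lt_one
  set γ := 1 - ρ with hγdef
  have hJ0 : (0 : ℝ) ≤ J := Nat.cast_nonneg J
  -- Consistency without a rate comes first: the uniform law makes `z_π` small at the market price.
  -- It is needed to control the quadratic error in the rate argument.
  have hconsist : ∀ κ > 0, ∀ᶠ x in whp μ, ‖P x.1 x.2 - p₀‖ ≤ κ := by
    intro κ hκ
    have hδ : 0 < γ * κ / (2 * (J + 1)) := by positivity
    have hlim : Tendsto (fun n => K₁ * h n) atTop (𝓝 0) := by simpa using hh.const_mul K₁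
    have hunif : ∀ᶠ x in whp μ, ∀ k, ∀ p ∈ priceBox l u,
        |(x.1 : ℝ)⁻¹ * ∑ i, M.excess k (A x.1 x.2 i, W x.1 x.2 i) p -
          ∫ y, M.excess k y p ∂(Θ.prod (treatmentLaw π))| < γ * κ / (2 * (J + 1)) :=
      eventually_all.2 fun k => hexp.eventually_uniform_average (hreg.smooth_excess k) hreg.convex
        hreg.isOpen (isCompact_priceBox l u) hsub hδ
    filter_upwards [hex, hP, hunif, tendsto_fst_whp.eventually (hlim.eventually_lt_const hδ)]
      with x hx hPx hux hhx
    have hzP : ‖M.z Θ π (P x.1 x.2)‖ ≤ J * (2 * (γ * κ / (2 * (J + 1)))) := by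
      refine norm_le_card_mul fun k => ?_
      rw [hreg.z_apply h0 h1 (hsub hPx.1)]
      have h2 := (hux k _ hPx.1).le
      have h3 := (hx k).2
      rw [abs_le] at h2 h3 ⊢
      constructor <;> linarith
    have h4 := hreg.le_norm_z_sub (hsub hPx.1) (hsub hp₀)
    rw [hz, sub_zero, ← hγdef] at h4
    have h5 : J * (2 * (γ * κ / (2 * (J + 1)))) ≤ γ * κ := by
      have : (J : ℝ) * (2 * (γ * κ / (2 * (J + 1)))) = J / (J + 1) * (γ * κ) := by field_simp
      rw [this]
      refine mul_le_of_le_one_left (by positivity) ?_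
      rw [div_le_one (by positivity)]
      linarith
    exact le_of_mul_le_mul_left (h4.trans (hzP.trans h5)) hγ
  have hη : 0 < γ / (4 * (J + 1) ^ 2) := by positivity
  have hderiv : ∀ᶠ x in whp μ, ∀ k, ∀ m, |(x.1 : ℝ)⁻¹ * ∑ i, fderiv ℝ
      (M.excess k (A x.1 x.2 i, W x.1 x.2 i)) p₀ (EuclideanSpace.single m 1) -
      ∫ y, fderiv ℝ (M.excess k y) p₀ (EuclideanSpace.single m 1) ∂(Θ.prod (treatmentLaw π))| ≤
        γ / (4 * (J + 1) ^ 2) := by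
    refine eventually_all.2 fun k => eventually_all.2 fun m => ?_
    have hb : ∀ y, |fderiv ℝ (M.excess k y) p₀ (EuclideanSpace.single m 1)| ≤ C := fun y => by
      have h2 := (fderiv ℝ (M.excess k y) p₀).le_opNorm (EuclideanSpace.single m 1)
      simp only [PiLp.norm_single, norm_one, mul_one] at h2
      exact h2.trans ((hreg.smooth_excess k).bound_fderiv y p₀ (hsub hp₀))
    have hlim := hexp.tendsto_average
      ((hreg.smooth_excess k).measurable_fderiv_apply (hsub hp₀) (EuclideanSpace.single m 1)) hb
    filter_upwards [Metric.tendsto_nhds.1 hlim _ hη] with x hx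
    exact hx.le
  refine ⟨4 * J * K₁ / γ, ?_⟩
  -- The radius and the derivative tolerance each contribute at most γ/(4(J+1)) to the coefficient
  -- of `d`. Over `J` coordinates this gives at most (γ/2)·d, so half of the lower bound γ·d
  -- survives.
  filter_upwards [hex, hP, hconsist (γ / (8 * (C + 1) * (J + 1))) (by positivity), hderiv,
    tendsto_fst_whp.eventually (eventually_gt_atTop 0)] with x hx hPx hdx hηx hn
  set d := ‖P x.1 x.2 - p₀‖ with hd
  have hd0 : 0 ≤ d := norm_nonneg _
  have hcoef : 2 * C * d + J * (γ / (4 * (J + 1) ^ 2)) ≤ γ / (2 * (J + 1)) := by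
    have h2 : 2 * C * d ≤ γ / (4 * (J + 1)) := by
      have h3 : 2 * C * d ≤ 2 * (C + 1) * (γ / (8 * (C + 1) * (J + 1))) := by gcongr; linarith
      refine h3.trans_eq ?_
      field_simp
      norm_num
    have h3 : J * (γ / (4 * (J + 1) ^ 2)) ≤ γ / (4 * (J + 1)) := by
      have : (J : ℝ) * (γ / (4 * (J + 1) ^ 2)) = J / (J + 1) * (γ / (4 * (J + 1))) := by field_simp
      rw [this]
      refine mul_le_of_le_one_left (by positivity) ?_
      rw [div_le_one (by positivity)]
      linarith
    have h4 : γ / (4 * (J + 1)) + γ / (4 * (J + 1)) = γ / (2 * (J + 1)) := by field_simp; norm_num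
    linarith
  have hzP : ‖M.z Θ π (P x.1 x.2)‖ ≤ J * (2 * (K₁ * h x.1) + γ / (2 * (J + 1)) * d) := by
    refine norm_le_card_mul fun k => ?_
    have h2 := (hreg.smooth_excess k).abs_increment_sub_increment_le hreg.convex hreg.isOpen
      (Θ.prod (treatmentLaw π)) (hsub hp₀) (hsub hPx.1) hn
      (fun i => (A x.1 x.2 i, W x.1 x.2 i)) (hηx k)
    rw [← hreg.z_apply h0 h1 (hsub hPx.1), ← hreg.z_apply h0 h1 (hsub hp₀), hz] at h2
    have h3 := h2.trans (mul_le_mul_of_nonneg_right hcoef hd0)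
    obtain ⟨h4, h5⟩ := hx k
    simp only [PiLp.zero_apply, sub_zero] at h3
    rw [abs_le] at h3 h4 h5 ⊢
    constructor <;> linarith
  have h4 := hreg.le_norm_z_sub (hsub hPx.1) (hsub hp₀)
  rw [hz, sub_zero, ← hγdef] at h4
  have h5 : J * (γ / (2 * (J + 1)) * d) ≤ γ / 2 * d := by
    have : (J : ℝ) * (γ / (2 * (J + 1)) * d) = J / (J + 1) * (γ / 2 * d) := by field_simp
    rw [this]
    refine mul_le_of_le_one_left (by positivity) ?_
    rw [div_le_one (by positivity)]
    linarith
  rw [div_mul_eq_mul_div, le_div_iff₀ hγ]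
  nlinarith

end Market.Regular

/-! ### Limits of least squares estimators -/

lemma tendsto_matrix_inv {α : Type*} {J : ℕ} {f : Filter α} {B : α → Matrix (Fin J) (Fin J) ℝ}
    {B₀ : Matrix (Fin J) (Fin J) ℝ} (hB : Tendsto B f (𝓝 B₀)) (h0 : B₀.det ≠ 0) :
    Tendsto (fun x => (B x)⁻¹) f (𝓝 B₀⁻¹) := by
  simp only [Matrix.inv_def, Ring.inverse_eq_inv']
  have h1 : Tendsto (fun x => (B x).det) f (𝓝 B₀.det) :=
    (continuous_id.matrix_det.tendsto B₀).comp hB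
  have h2 : Tendsto (fun x => (B x).adjugate) f (𝓝 B₀.adjugate) :=
    (continuous_id.matrix_adjugate.tendsto B₀).comp hB
  exact (h1.inv₀ h0).smul h2

lemma tendsto_mulVec {α : Type*} {J : ℕ} {f : Filter α} {B : α → Matrix (Fin J) (Fin J) ℝ}
    {B₀ : Matrix (Fin J) (Fin J) ℝ} {v : α → Fin J → ℝ} {v₀ : Fin J → ℝ}
    (hB : Tendsto B f (𝓝 B₀)) (hv : Tendsto v f (𝓝 v₀)) :
    Tendsto (fun x => B x *ᵥ v x) f (𝓝 (B₀ *ᵥ v₀)) := by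
  have hc : Continuous fun y : Matrix (Fin J) (Fin J) ℝ × (Fin J → ℝ) => y.1 *ᵥ y.2 :=
    continuous_fst.matrix_mulVec continuous_snd
  exact (hc.tendsto (B₀, v₀)).comp (hB.prodMk_nhds hv)

/-- The scale `s` cancels between the Gram matrix and the cross products. The normalized Gram matrix
tends to the identity, so it is eventually invertible and inversion is continuous at the limit. -/
lemma tendsto_ols {α : Type*} {J : ℕ} {f : Filter α} {n : α → ℕ}
    {U : (x : α) → Matrix (Fin (n x)) (Fin J) ℝ} {v : (x : α) → Fin (n x) → ℝ} {s : α → ℝ}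
    {b : Fin J → ℝ} (hs : ∀ᶠ x in f, s x ≠ 0)
    (hgram : ∀ j k, Tendsto (fun x => (s x)⁻¹ * ∑ i, U x i j * U x i k) f
      (𝓝 (if j = k then 1 else 0)))
    (hcross : ∀ j, Tendsto (fun x => (s x)⁻¹ * ∑ i, U x i j * v x i) f (𝓝 (b j))) :
    Tendsto (fun x => ols (U x) (v x)) f (𝓝 b) := by
  have hQ : Tendsto (fun x => (s x)⁻¹ • ((U x)ᵀ * U x)) f (𝓝 1) := by
    refine tendsto_pi_nhds.2 fun j => tendsto_pi_nhds.2 fun k => ?_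
    simpa [Matrix.mul_apply, Matrix.one_apply] using hgram j k
  have hc : Tendsto (fun x => (s x)⁻¹ • ((U x)ᵀ *ᵥ v x)) f (𝓝 b) := by
    refine tendsto_pi_nhds.2 fun j => ?_
    simpa [Matrix.mulVec, dotProduct] using hcross j
  have hlim := tendsto_mulVec (tendsto_matrix_inv hQ (by simp)) hc
  rw [inv_one, Matrix.one_mulVec] at hlim
  refine hlim.congr' ?_
  have hdet : Tendsto (fun x => ((s x)⁻¹ • ((U x)ᵀ * U x)).det) f
      (𝓝 (1 : Matrix (Fin J) (Fin J) ℝ).det) := (continuous_id.matrix_det.tendsto _).comp hQ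
  rw [Matrix.det_one] at hdet
  filter_upwards [hs, hdet.eventually_ne one_ne_zero] with x hx hd
  have hG : IsUnit ((U x)ᵀ * U x).det := by
    rw [Matrix.det_smul] at hd
    exact isUnit_iff_ne_zero.2 (right_ne_zero_of_mul hd)
  have := invertibleOfNonzero (inv_ne_zero hx)
  rw [Matrix.inv_smul _ _ hG, invOf_eq_inv, inv_inv, Matrix.smul_mulVec, Matrix.mulVec_smul,
    smul_smul, mul_inv_cancel₀ hx, one_smul, ols]

/-! ### Horvitz–Thompson weights -/

lemma horvitzThompson_eq {n : ℕ} (π : ℝ) (w : Fin n → Bool) (v : Fin n → ℝ) :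
    horvitzThompson π w v = (n : ℝ)⁻¹ * ∑ i, treatmentWeight π (w i) * v i := by
  rw [horvitzThompson]
  congr 1
  refine Finset.sum_congr rfl fun i _ => ?_
  rw [treatmentWeight]
  ring

lemma abs_treatmentWeight_le (π : ℝ) (w : Bool) :
    |treatmentWeight π w| ≤ |1 / π| + |1 / (1 - π)| := by
  cases w <;> simp [treatmentWeight]

lemma SmoothFamily.treatmentWeight_mul {J : ℕ} {G : Type*} [MeasurableSpace G]
    {F : G × Bool → Price J → ℝ} {V : Set (Price J)} {C : ℝ} (hF : SmoothFamily F V C) (π : ℝ) :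
    SmoothFamily (fun x p => treatmentWeight π x.2 * F x p) V ((|1 / π| + |1 / (1 - π)|) * C) :=
  hF.weight (a := fun x => treatmentWeight π x.2)
    ((measurable_of_countable (treatmentWeight π)).comp measurable_snd)
    fun x => abs_treatmentWeight_le π x.2

/-- The weights 1/π and -1/(1 - π) cancel the treatment probabilities, which makes the
Horvitz–Thompson contrast unbiased. -/
lemma SmoothFamily.integral_treatmentWeight_mul {J : ℕ} {G : Type*} [MeasurableSpace G]
    {F : G × Bool → Price J → ℝ} {V : Set (Price J)} {C : ℝ} (hF : SmoothFamily F V C)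
    {Θ : Measure G} [IsProbabilityMeasure Θ] {π : ℝ} (h0 : 0 < π) (h1 : π < 1) {p : Price J}
    (hp : p ∈ V) :
    ∫ x, treatmentWeight π x.2 * F x p ∂(Θ.prod (treatmentLaw π)) =
      ∫ g, F (g, true) p ∂Θ - ∫ g, F (g, false) p ∂Θ := by
  have := isProbabilityMeasure_treatmentLaw h0.le h1.le
  have hs := hF.treatmentWeight_mul π
  have h2 := integral_prod_treatmentLaw h0.le h1.le (hs.integrable (Θ.prod (treatmentLaw π)) hp)
    fun w => (hs.comp (f := fun g : G => (g, w)) (by fun_prop)).integrable Θ hp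
  have h1π : 1 - π ≠ 0 := (sub_pos.2 h1).ne'
  have ht : treatmentWeight π true = 1 / π := by simp [treatmentWeight]
  have hf : treatmentWeight π false = -(1 / (1 - π)) := by simp [treatmentWeight]
  rw [h2]
  simp only [ht, hf, integral_const_mul]
  field_simp
  ring

/-! ### The perturbation scale -/

lemma tendsto_const_mul_rpow_neg (c : ℝ) {α : ℝ} (hα : 0 < α) :
    Tendsto (fun n : ℕ => c * (n : ℝ) ^ (-α)) atTop (𝓝 0) := by
  simpa using ((tendsto_rpow_neg_atTop hα).comp tendsto_natCast_atTop_atTop).const_mul c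

lemma tendsto_mul_sq_const_mul_rpow_neg {c : ℝ} (hc : 0 < c) {α : ℝ} (hα : α < 1 / 2) :
    Tendsto (fun n : ℕ => (n : ℝ) * (c * (n : ℝ) ^ (-α)) ^ 2) atTop atTop := by
  have h1 : Tendsto (fun n : ℕ => c ^ 2 * (n : ℝ) ^ (1 - 2 * α)) atTop atTop :=
    ((tendsto_rpow_atTop (by linarith)).comp tendsto_natCast_atTop_atTop).const_mul_atTop
      (by positivity)
  refine h1.congr' ?_
  filter_upwards [eventually_gt_atTop 0] with n hn
  have hn' : (0 : ℝ) < n := by exact_mod_cast hn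
  rw [mul_pow, ← Real.rpow_natCast ((n : ℝ) ^ (-α)) 2, ← Real.rpow_mul hn'.le]
  have : (n : ℝ) ^ (1 - 2 * α) = n * (n : ℝ) ^ (-α * ((2 : ℕ) : ℝ)) := by
    rw [← Real.rpow_one_add' hn'.le]
    · congr 1
      push_cast
      ring
    · push_cast
      linarith
  rw [this]
  ring

end

/-! ### Consistency of the two estimators -/

theorem theorem2 {J : ℕ} {G Ω : Type*} [MeasurableSpace G] [MeasurableSpace Ω]
    (M : Market J G) (Θ : Measure G) [IsProbabilityMeasure Θ]
    (l u : Price J) (π : ℝ) (hπ0 : 0 < π) (hπ1 : π < 1)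
    (hM : M.Assumptions Θ l u π)
    (c α : ℝ) (hc : 0 < c) (hα : 1 / 4 < α) (hα' : α < 1 / 2)
    (μ : Measure Ω) [IsProbabilityMeasure μ]
    (A : (n : ℕ) → Ω → Fin n → G) (W : (n : ℕ) → Ω → Fin n → Bool)
    (U : (n : ℕ) → Ω → Matrix (Fin n) (Fin J) ℝ)
    (hexp : IsAugmentedExperiment μ Θ π (fun n => c * (n : ℝ) ^ (-α)) A W U)
    (P : ℕ → Ω → Price J)
    (hP : ∀ᶠ n in atTop, ∀ᵐ ω ∂μ, M.IsMarketPrice l u (A n ω) (W n ω) (U n ω) (P n ω)) :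
    -- the mean-field quantities are well defined
    (∀ᶠ q in 𝓝 π, ∃! p, M.IsMeanFieldPrice Θ l u q p) ∧
    DifferentiableAt ℝ (M.pStar Θ l u) π ∧
    DifferentiableAt ℝ (M.yBar Θ π) (M.pStar Θ l u π) ∧
    -- consistency of the two estimators
    TendstoInMeasure μ (fun n ω => M.tauHatADE π (A n ω) (W n ω) (U n ω) (P n ω)) atTop
      (fun _ => M.tauStarADE Θ l u π) ∧
    TendstoInMeasure μ (fun n ω => M.tauHatAIE π (A n ω) (W n ω) (U n ω) (P n ω)) atTop
      (fun _ => M.tauStarAIE Θ l u π) := by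
  have hprob := isProbabilityMeasure_treatmentLaw hπ0.le hπ1.le
  obtain ⟨r, C, ρ, hr, hreg⟩ := hM.exists_regular
  set V := Metric.thickening r (priceBox l u) with hV
  have hbox : priceBox l u ⊆ V := Metric.self_subset_thickening hr _
  obtain ⟨⟨hp₀, hz⟩, hint⟩ := hreg.isMeanFieldPrice_pStar hr hπ0.le hπ1.le hM
  obtain ⟨hex, d, hd, hAd⟩ := hreg.hasDerivAt_pStar hbox hz hint hM.jacobian_full_rank
  set p₀ := M.pStar Θ l u π with hp₀def
  have hp₀V := hbox hp₀
  have hyBar : M.yBar Θ π =ᶠ[𝓝 p₀] fun p => ∫ x, M.outcome x p ∂(Θ.prod (treatmentLaw π)) := by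
    filter_upwards [hreg.isOpen.mem_nhds hp₀V] with p hp
    rw [integral_prod_treatmentLaw hπ0.le hπ1.le (hreg.smooth_outcome.integrable _ hp) fun w =>
      (hreg.smooth_outcome.comp (f := fun g : G => (g, w)) (by fun_prop)).integrable Θ hp]
    rfl
  have hydiff : DifferentiableAt ℝ (M.yBar Θ π) p₀ := hyBar.differentiableAt_iff.2
    (hreg.smooth_outcome.hasFDerivAt_integral _ hreg.isOpen hp₀V).differentiableAt
  refine ⟨hex, hd.differentiableAt, hydiff, ?_⟩
  set h : ℕ → ℝ := fun n => c * (n : ℝ) ^ (-α) with hhdef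
  have hpos : ∀ᶠ n in atTop, 0 < h n := by
    filter_upwards [eventually_gt_atTop 0] with n hn
    have : (0 : ℝ) < n := by exact_mod_cast hn
    positivity
  have hh : Tendsto h atTop (𝓝 0) := tendsto_const_mul_rpow_neg c (by linarith)
  have hnh : Tendsto (fun n : ℕ => n * h n ^ 2) atTop atTop :=
    tendsto_mul_sq_const_mul_rpow_neg hc hα'
  have hPw : ∀ᶠ x in whp μ, M.IsMarketPrice l u (A x.1 x.2) (W x.1 x.2) (U x.1 x.2) (P x.1 x.2) :=
    eventually_whp_of_ae hP
  obtain ⟨K, hPK⟩ := hreg.exists_eventually_norm_sub_le hr hπ0.le hπ1.le hexp hpos hh hnh hp₀ hz hPw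
  have hPV : ∀ᶠ x in whp μ, ∀ i, Market.facedPrice (U x.1 x.2) (P x.1 x.2) i ∈ V := by
    filter_upwards [hPw, Market.Regular.eventually_facedPrice_mem hr hexp hpos hh] with x h1 h2
    exact h2 _ h1.1
  constructor
  · refine tendstoInMeasure_of_tendsto_whp ?_
    have hlim := hexp.tendsto_average_facedPrice hpos hh
      (hreg.smooth_outcome.treatmentWeight_mul π) hreg.convex hp₀V hPV hPK
    rw [hreg.smooth_outcome.integral_treatmentWeight_mul hπ0 hπ1 hp₀V] at hlim
    simp only [Market.tauHatADE, horvitzThompson_eq]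
    exact hlim
  · refine tendstoInMeasure_of_tendsto_whp ?_
    have hs : ∀ᶠ x : ℕ × Ω in whp μ, (x.1 * h x.1 ^ 2 : ℝ) ≠ 0 := by
      filter_upwards [tendsto_fst_whp.eventually hpos,
        tendsto_fst_whp.eventually (eventually_gt_atTop 0)] with x h1 h2
      have : (0 : ℝ) < x.1 := by exact_mod_cast h2
      positivity
    have hgram : ∀ j k, Tendsto (fun x : ℕ × Ω => (x.1 * h x.1 ^ 2)⁻¹ *
        ∑ i, U x.1 x.2 i j * U x.1 x.2 i k) (whp μ) (𝓝 (if j = k then 1 else 0)) := by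
      intro j k
      have h1 := hexp.tendsto_average_mul_mul hpos (a := fun _ => 1) (C := 1) measurable_const
        (by simp) j k
      simp only [integral_const, probReal_univ, smul_eq_mul, mul_one, one_mul] at h1
      refine h1.congr fun x => ?_
      rw [Finset.mul_sum, Finset.mul_sum]
      refine Finset.sum_congr rfl fun i _ => ?_
      rw [mul_inv, div_mul_div_comm, div_eq_mul_inv, ← pow_two]
      ring
    set e : Fin J → Price J := fun j => EuclideanSpace.single j 1 with he
    have hY : Tendsto (fun x : ℕ × Ω => ols (U x.1 x.2)
        (M.obsY (A x.1 x.2) (W x.1 x.2) (U x.1 x.2) (P x.1 x.2))) (whp μ)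
        (𝓝 fun j => fderiv ℝ (M.yBar Θ π) p₀ (e j)) := by
      refine tendsto_ols hs hgram fun j => ?_
      rw [hyBar.fderiv_eq]
      exact hexp.tendsto_regression hpos hh hnh hreg.smooth_outcome hreg.convex hreg.isOpen hp₀V
        hPV hPK j
    -- The matrix of the Jacobian of `z_π` at `p₀`, with rows indexed by goods and columns by
    -- prices, as in `jacobianHat`.
    set B : Matrix (Fin J) (Fin J) ℝ := Matrix.of fun k j => (fderiv ℝ (M.z Θ π) p₀ (e j)) k with hB
    have hzk : ∀ k v, fderiv ℝ (fun p => ∫ y, M.excess k y p ∂(Θ.prod (treatmentLaw π))) p₀ v =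
        (fderiv ℝ (M.z Θ π) p₀ v) k := by
      intro k v
      have h1 : (fun p => ∫ y, M.excess k y p ∂(Θ.prod (treatmentLaw π))) =ᶠ[𝓝 p₀]
          fun p => (M.z Θ π p) k := by
        filter_upwards [hreg.isOpen.mem_nhds hp₀V] with p hp
        exact (hreg.z_apply hπ0.le hπ1.le hp k).symm
      have h2 := ((hreg.contDiffAt_z π hp₀V).hasStrictFDerivAt (n := 1) (by norm_num))
      have h3 := ((hasStrictFDerivAt_euclidean.1 h2) k).hasFDerivAt
      rw [h1.fderiv_eq, h3.fderiv]
      rfl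
    have hZ : Tendsto (fun x : ℕ × Ω => jacobianHat (U x.1 x.2)
        (M.obsZ (A x.1 x.2) (W x.1 x.2) (U x.1 x.2) (P x.1 x.2))) (whp μ) (𝓝 B) := by
      refine tendsto_pi_nhds.2 fun k => ?_
      refine tendsto_ols hs hgram fun j => ?_
      have h1 := hexp.tendsto_regression hpos hh hnh (hreg.smooth_excess k) hreg.convex hreg.isOpen
        hp₀V hPV hPK j
      rw [hzk] at h1
      exact h1
    have hT : Tendsto (fun x : ℕ × Ω => fun k => horvitzThompson π (W x.1 x.2)
        (fun i => M.obsZ (A x.1 x.2) (W x.1 x.2) (U x.1 x.2) (P x.1 x.2) i k)) (whp μ)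
        (𝓝 fun k => (M.zCond Θ true p₀ - M.zCond Θ false p₀) k) := by
      refine tendsto_pi_nhds.2 fun k => ?_
      have hlim := hexp.tendsto_average_facedPrice hpos hh
        ((hreg.smooth_excess k).treatmentWeight_mul π) hreg.convex hp₀V hPV hPK
      rw [(hreg.smooth_excess k).integral_treatmentWeight_mul hπ0 hπ1 hp₀V,
        ← hreg.zCond_apply true p₀ hp₀V, ← hreg.zCond_apply false p₀ hp₀V] at hlim
      simp only [horvitzThompson_eq]
      exact hlim
    have hBv : ∀ v : Price J, B *ᵥ v = fderiv ℝ (M.z Θ π) p₀ v := by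
      intro v
      ext k
      rw [← hzk, clm_apply_eq_sum]
      simp [Matrix.mulVec, dotProduct, hB, hzk, he, mul_comm]
    have hBinj : Function.Injective B.mulVec := by
      intro v w hvw
      have h1 := hBv (WithLp.toLp 2 v)
      have h2 := hBv (WithLp.toLp 2 w)
      have h3 := hM.jacobian_full_rank.1 (WithLp.ofLp_injective 2 ((h1.symm.trans hvw).trans h2))
      exact WithLp.toLp_injective 2 h3
    have hBu : IsUnit B.det := (Matrix.isUnit_iff_isUnit_det B).1
      (Matrix.mulVec_injective_iff_isUnit.1 hBinj)
    -- The differentiated clearing condition says that `B` maps `-d` to the treatment effect on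
    -- excess demand; its minus sign cancels the one in the estimator.
    have hsol : B⁻¹ *ᵥ (fun k => (M.zCond Θ true p₀ - M.zCond Θ false p₀) k) = -(d : Fin J → ℝ) := by
      have h1 : B *ᵥ (-(d : Fin J → ℝ)) = fun k => (M.zCond Θ true p₀ - M.zCond Θ false p₀) k := by
        rw [Matrix.mulVec_neg, hBv d, hAd]
        ext k
        simp
      rw [← h1, Matrix.mulVec_mulVec, Matrix.nonsing_inv_mul _ hBu, Matrix.one_mulVec]
    have hprod := tendsto_mulVec (tendsto_matrix_inv hZ hBu.ne_zero) hT
    rw [hsol] at hprod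
    have hdot : Continuous fun y : (Fin J → ℝ) × (Fin J → ℝ) => -(y.1 ⬝ᵥ y.2) :=
      (continuous_fst.dotProduct continuous_snd).neg
    have hfinal := (hdot.tendsto _).comp (hY.prodMk_nhds hprod)
    have hval : M.tauStarAIE Θ l u π =
        -((fun j => fderiv ℝ (M.yBar Θ π) p₀ (e j)) ⬝ᵥ (-(d : Fin J → ℝ))) := by
      rw [Market.tauStarAIE, hd.deriv, gradient, InnerProductSpace.toDual_symm_apply,
        ← hp₀def, clm_apply_eq_sum]
      simp [dotProduct, he, mul_comm]
    rw [hval]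
    exact hfinal
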